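/- Let $\mathfrak H$ be a real separable Hilbert space and let $X=\{X(h):h\in\mathfrak H\}$ be a centered isonormal Gaussian process over $\mathfrak H$ on a probability space $(\Omega,\mathscr F,P)$: a jointly Gaussian family of centered random variables with $E(X(h)X(k))=\langle h,k\rangle_{\mathfrak H}$ for all $h,k\in\mathfrak H$. For a smooth cylindrical random variable $F=f(X(\phi_1),\dots,X(\phi_n))$, with $n\ge 1$, $f:\mathbb R^n\to\mathbb R$ smooth with compact support and $\phi_i\in\mathfrak H$, put $DF=\sum_{i=1}^n\frac{\partial f}{\partial x_i}(X(\phi_1),\dots,X(\phi_n))\,\phi_i\in L^2(\Omega;\mathfrak H)$. Let $\mathbb D^{1,2}\subset L^2(\Omega)$ be the closure of the set of these random variables in the norm $\|F\|_{1,2}^2=E(F^2)+E(\|DF\|_{\mathfrak H}^2)$, and let $D:\mathbb D^{1,2}\to L^2(\Omega;\mathfrak H)$ be the closure of $D$. Let $J_m$ be the orthogonal projection of $L^2(\Omega)$ onto the $m$-th Wiener chaos, which for $m\ge1$ is the closed linear span of $\{H_m(X(h)):\|h\|_{\mathfrak H}=1\}$ with $H_m$ the $m$-th Hermite polynomial,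 and let $L^{-1}Z=-\sum_{m\ge1}\frac1m J_mZ$ for $Z\in L^2(\Omega)$. Let $Z\in\mathbb D^{1,2}$ with $E(Z)=0$, and let $g(Z):=E\big(\langle DZ,-DL^{-1}Z\rangle_{\mathfrak H}\,\big|\,Z\big)$. If there exist $\sigma_{\min},\sigma_{\max}>0$ such that $$\sigma_{\min}^2\le g(Z)\le\sigma_{\max}^2\quad\text{almost surely},$$ then $Z$ has a density $\rho$ with respect to Lebesgue measure satisfying, for almost all $z\in\mathbb R$, $$\frac{E|Z|}{2\sigma_{\max}^2}\exp\Big(-\frac{z^2}{2\sigma_{\min}^2}\Big)\le\rho(z)\le\frac{E|Z|}{2\sigma_{\min}^2}\exp\Big(-\frac{z^2}{2\sigma_{\max}^2}\Big).$$ -/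

import Mathlib

open MeasureTheory ProbabilityTheory
open scoped InnerProductSpace

noncomputable section

namespace Malliavin

variable {Ω H : Type*} [NormedAddCommGroup H] [InnerProductSpace ℝ H] [mΩ : MeasurableSpace Ω]

/-- `X = {X h : h ∈ H}` is a centered isonormal Gaussian process over `H`: a jointly Gaussian
family of centered random variables with `E (X h * X k) = ⟪h, k⟫`. -/
structure IsIsonormal (X : H → Ω → ℝ) (P : Measure Ω) : Prop where
  isGaussian : IsGaussianProcess X P
  centered : ∀ h, ∫ ω, X h ω ∂P = 0
  covariance : ∀ h k, ∫ ω, X h ω * X k ω ∂P = ⟪h, k⟫_ℝ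

/-- The graph of the Malliavin derivative on smooth cylindrical random variables: all pairs
`(F, DF)` in `L²(Ω) × L²(Ω; H)` where `F = f (X φ₁, …, X φₙ)` with `n ≥ 1`, `f : ℝⁿ → ℝ` smooth
with compact support, `φᵢ ∈ H`, and `DF = ∑ᵢ ∂ᵢf (X φ₁, …, X φₙ) φᵢ`. -/
def smoothGraph (X : H → Ω → ℝ) (P : Measure Ω) : Set (Lp ℝ 2 P × Lp H 2 P) :=
  {p | ∃ (n : ℕ) (φ : Fin n → H) (f : (Fin n → ℝ) → ℝ),
    1 ≤ n ∧ ContDiff ℝ (⊤ : ℕ∞) f ∧ HasCompactSupport f ∧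
    (p.1 =ᵐ[P] fun ω => f (fun j => X (φ j) ω)) ∧
    (p.2 =ᵐ[P] fun ω => ∑ i, (fderiv ℝ f (fun j => X (φ j) ω) (Pi.single i 1)) • φ i)}

/-- `U` is a Malliavin derivative of `Z`: `(Z, U)` lies in the closure of the graph of `D` on
smooth cylindrical random variables, that is, there are smooth cylindrical `Fₙ` with `Fₙ → Z` in
`L²(Ω)` and `DFₙ → U` in `L²(Ω; H)`. -/
def IsDeriv (X : H → Ω → ℝ) (P : Measure Ω) (Z : Lp ℝ 2 P) (U : Lp H 2 P) : Prop :=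
  (Z, U) ∈ closure (smoothGraph X P)

/-- The space `𝔻^{1,2}`: the closure of the smooth cylindrical random variables in the norm
`‖Z‖² = E Z² + E ‖DZ‖²`. -/
def D12 (X : H → Ω → ℝ) (P : Measure Ω) : Set (Lp ℝ 2 P) :=
  {Z | ∃ U, IsDeriv X P Z U}

open Classical in
/-- The Malliavin derivative `D : 𝔻^{1,2} → L²(Ω; H)`, extended by `0` outside `𝔻^{1,2}`. For an
isonormal process `D` is closable, so that the chosen derivative is the only one. -/
def deriv (X : H → Ω → ℝ) (P : Measure Ω) (Z : Lp ℝ 2 P) : Lp H 2 P :=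
  if h : ∃ U, IsDeriv X P Z U then h.choose else 0

/-- The `m`-th Wiener chaos: the closed linear span in `L²(Ω)` of the random variables
`Hₘ (X h)` with `‖h‖ = 1`, where `Hₘ` is the `m`-th Hermite polynomial (for `m = 0` every `h` is
admitted, so that the chaos of order zero is the space of constants even if `H` is trivial). -/
def chaos (X : H → Ω → ℝ) (P : Measure Ω) (m : ℕ) : Submodule ℝ (Lp ℝ 2 P) :=
  (Submodule.span ℝ {F : Lp ℝ 2 P | ∃ h : H, (m = 0 ∨ ‖h‖ = 1) ∧
    F =ᵐ[P] fun ω => Polynomial.aeval (X h ω) (Polynomial.hermite m)}).topologicalClosure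

instance chaos_completeSpace (X : H → Ω → ℝ) (P : Measure Ω) (m : ℕ) : CompleteSpace (chaos X P m) :=
  Submodule.topologicalClosure.completeSpace _

/-- The orthogonal projection `Jₘ` of `L²(Ω)` onto the `m`-th Wiener chaos. -/
def chaosProj (X : H → Ω → ℝ) (P : Measure Ω) (m : ℕ) (Z : Lp ℝ 2 P) : Lp ℝ 2 P :=
  (chaos X P m).starProjection Z

/-- The pseudo-inverse `L⁻¹ Z = ∑_{m ≥ 1} -(1/m) Jₘ Z` of the generator of the Ornstein-Uhlenbeck
semigroup; the series of orthogonal terms converges in `L²(Ω)`. -/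
def Linv (X : H → Ω → ℝ) (P : Measure Ω) (Z : Lp ℝ 2 P) : Lp ℝ 2 P :=
  ∑' m : ℕ, (-(1 / ((m + 1 : ℕ) : ℝ))) • chaosProj X P (m + 1) Z

/-- The random variable `g(Z) = E (⟪DZ, -D L⁻¹ Z⟫ | Z)`. -/
def gZ (X : H → Ω → ℝ) (P : Measure Ω) (Z : Lp ℝ 2 P) : Ω → ℝ :=
  condExp (MeasurableSpace.comap (fun ω => Z ω) (borel ℝ)) P
    (fun ω => ⟪deriv X P Z ω, -(deriv X P (Linv X P Z) ω)⟫_ℝ)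

end Malliavin

end

open Filter Topology

namespace Malliavin

/-! Everything rests on one integration by parts formula: E(Z u(Z)) = E(u'(Z) g(Z)) for smooth u
with bounded derivative and u(0) = 0 (`integral_mul_comp_eq`).

Its source is spectral. Gaussian integration by parts gives D*(Hₙ(X h) h) = Hₙ₊₁(X h) for unit h,
while D Hₙ₊₁(X h) = (n+1) Hₙ(X h) h. So D*D acts as the scalar m on the m-th chaos
(`chaos_le_eigenspace`). Dividing each chaos component by m and summing yields -L⁻¹Z, and D*D(-L⁻¹Z)
= ∑_{m ≥ 1} Jₘ Z (`exists_deriv_tsum_starProjection`). This sum is Z, because elements of the domain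
of D are the sum of their chaos components (`tsum_chaosProj`) and E Z = 0 removes J₀. Hence E⟨DF,
-DL⁻¹Z⟩ = E(F Z) for all F in the domain (`inner_deriv_Linv`). The chain rule
(`comp_mem_derivGraph`) allows F = u(Z), and conditioning on Z produces g(Z).

The rest is real analysis (`hasPDF_and_bounds`). Put η(y) = E(Z 1_{Z ≥ y}). Taking for u the
primitive of a test function h, Fubini turns the formula into E(h(Z) g(Z)) = ∫ h η, so the law of Z
weighted by g has Lebesgue density η (`map_withDensity_eq`). With s = σmin² and S = σmax², the
bounds s ≤ g ≤ S force the law of Z itself to have a density ρ with sρ ≤ η ≤ Sρ. Since η' = -zρ in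
integrated form, η satisfies -zη/s ≤ η' ≤ -zη/S for z ≥ 0, and the reflected statement for z ≤ 0.
Grönwall starting from η(0) = E|Z|/2 encloses η between two Gaussians, and sρ ≤ η ≤ Sρ carries this
over to ρ. -/

/-! ### Hermite polynomials and the Gaussian measure on the line -/

open Polynomial in
lemma memLp_aeval_of_hasGaussianLaw {Ω : Type*} [MeasurableSpace Ω] {P : Measure Ω} {Y : Ω → ℝ}
    (hY : HasGaussianLaw Y P) (p : ℤ[X]) : MemLp (fun ω => aeval (Y ω) p) 2 P := by
  have hprob := hY.isProbabilityMeasure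
  have hpow : ∀ k : ℕ, MemLp (fun ω => Y ω ^ k) 2 P := by
    intro k
    rw [memLp_two_iff_integrable_sq (hY.aemeasurable.pow_const k).aestronglyMeasurable]
    have h := (hY.memLp (p := ((2 * k : ℕ) : ENNReal))
      (ENNReal.natCast_ne_top _)).integrable_norm_pow'
    refine h.congr (Filter.Eventually.of_forall fun ω => ?_)
    simp only [Real.norm_eq_abs]
    rw [pow_mul, sq_abs, ← pow_mul, ← pow_mul, mul_comm]
  simp only [aeval_eq_sum_range]
  exact memLp_finsetSum _ fun i _ => by simpa [zsmul_eq_mul] using (hpow i).const_mul _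

lemma hasDerivAt_aeval_hermite (n : ℕ) (x : ℝ) :
    HasDerivAt (fun x : ℝ => Polynomial.aeval x (Polynomial.hermite n))
      (x * Polynomial.aeval x (Polynomial.hermite n)
        - Polynomial.aeval x (Polynomial.hermite (n + 1))) x := by
  convert! Polynomial.hasDerivAt_aeval (Polynomial.hermite n) x using 1
  simp [Polynomial.hermite_succ]

lemma hasDerivAt_gaussianPDFReal (x : ℝ) :
    HasDerivAt (gaussianPDFReal 0 1) (-x * gaussianPDFReal 0 1 x) x := by
  have h : HasDerivAt (fun x : ℝ => (√(2 * Real.pi * (1 : NNReal)))⁻¹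
      * Real.exp (-(x - 0) ^ 2 / (2 * (1 : NNReal)))) ((√(2 * Real.pi * (1 : NNReal)))⁻¹
      * (Real.exp (-(x - 0) ^ 2 / (2 * (1 : NNReal))) *
        ((-(2 * (x - 0) ^ (2 - 1) * 1)) / (2 * (1 : NNReal))))) x :=
    ((((((hasDerivAt_id x).sub_const 0).pow 2).neg.div_const _).exp).const_mul _)
  refine h.congr_deriv ?_
  simp only [gaussianPDFReal]
  norm_num
  ring

/-- The term x Hₙ in the derivative of Hₙ cancels against the derivative -xγ of the Gaussian density
γ. This is why integration by parts against Hₙ raises the index by one. -/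
lemma hasDerivAt_hermite_mul_gaussianPDFReal (n : ℕ) (x : ℝ) :
    HasDerivAt (fun x => Polynomial.aeval x (Polynomial.hermite n) * gaussianPDFReal 0 1 x)
      (-(Polynomial.aeval x (Polynomial.hermite (n + 1)) * gaussianPDFReal 0 1 x)) x := by
  refine ((hasDerivAt_aeval_hermite n x).mul (hasDerivAt_gaussianPDFReal x)).congr_deriv ?_
  ring

lemma integrable_hermite_gaussianReal (n : ℕ) :
    Integrable (fun x : ℝ => Polynomial.aeval x (Polynomial.hermite n)) (gaussianReal 0 1) :=
  (memLp_aeval_of_hasGaussianLaw (P := gaussianReal 0 1) (Y := id)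
    IsGaussian.hasGaussianLaw_id _).integrable (by norm_num)

/-- Gaussian integration by parts on the line, against Hermite polynomials. -/
lemma integral_deriv_mul_hermite {f f' : ℝ → ℝ} {C : ℝ} (hf : ∀ x, HasDerivAt f (f' x) x)
    (hC : ∀ x, |f x| ≤ C) (hC' : ∀ x, |f' x| ≤ C) (n : ℕ) :
    ∫ x, f' x * Polynomial.aeval x (Polynomial.hermite n) ∂gaussianReal 0 1
      = ∫ x, f x * Polynomial.aeval x (Polynomial.hermite (n + 1)) ∂gaussianReal 0 1 := by
  have hfc : Continuous f := continuous_iff_continuousAt.2 fun x => (hf x).continuousAt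
  have hf'm : Measurable f' := by
    have : f' = _root_.deriv f := funext fun x => (hf x).deriv.symm
    rw [this]; exact measurable_deriv f
  have key : ∀ (g : ℝ → ℝ), Measurable g → (∀ x, |g x| ≤ C) → ∀ m,
      Integrable (fun x => g x *
        (Polynomial.aeval x (Polynomial.hermite m) * gaussianPDFReal 0 1 x)) := by
    intro g hg hgC m
    have h1 : Integrable (fun x => g x * Polynomial.aeval x (Polynomial.hermite m))
        (gaussianReal 0 1) :=
      (integrable_hermite_gaussianReal m).bdd_mul hg.aestronglyMeasurable
        (Filter.Eventually.of_forall hgC)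
    rw [gaussianReal_of_var_ne_zero _ one_ne_zero,
      integrable_withDensity_iff_integrable_smul' (measurable_gaussianPDF _ _)
        (ae_of_all _ fun _ ↦ gaussianPDF_lt_top)] at h1
    refine h1.congr (Filter.Eventually.of_forall fun x => ?_)
    simp only [toReal_gaussianPDF, smul_eq_mul]
    ring
  have h := integral_mul_deriv_eq_deriv_mul_of_integrable (u := f) (u' := f')
    (v := fun x => Polynomial.aeval x (Polynomial.hermite n) * gaussianPDFReal 0 1 x)
    (v' := fun x => -(Polynomial.aeval x (Polynomial.hermite (n + 1)) * gaussianPDFReal 0 1 x))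
    (fun x _ => hf x) (fun x _ => hasDerivAt_hermite_mul_gaussianPDFReal n x)
    (by simpa [Pi.mul_def] using (key f hfc.measurable hC (n + 1)).neg)
    (key f' hf'm hC' n) (key f hfc.measurable hC n)
  simp only [mul_neg, integral_neg, neg_inj] at h
  rw [integral_gaussianReal_eq_integral_smul one_ne_zero,
    integral_gaussianReal_eq_integral_smul one_ne_zero]
  simp only [smul_eq_mul]
  calc _ = ∫ x, f' x * (Polynomial.aeval x (Polynomial.hermite n) * gaussianPDFReal 0 1 x) := by
        congr 1; ext x; ring
    _ = _ := by rw [← h]; congr 1; ext x; ring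

/-! ### Gaussian integration by parts for an isonormal process -/

section Isonormal

variable {Ω H : Type*} [NormedAddCommGroup H] [InnerProductSpace ℝ H] [MeasurableSpace Ω]
  {X : H → Ω → ℝ} {P : Measure Ω}

namespace IsIsonormal

lemma memLp (hX : IsIsonormal X P) (h : H) : MemLp (X h) 2 P :=
  (hX.isGaussian.hasGaussianLaw_eval h).memLp_two

lemma hasGaussianLaw_pi (hX : IsIsonormal X P) {κ : Type*} [Fintype κ] (ψ : κ → H) :
    HasGaussianLaw (fun ω i => X (ψ i) ω) P := by
  classical
  have hmem : ∀ i, ψ i ∈ Finset.univ.image ψ := by simp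
  let T : (Finset.univ.image ψ → ℝ) →L[ℝ] (κ → ℝ) :=
    ContinuousLinearMap.pi fun i => ContinuousLinearMap.proj ⟨ψ i, hmem i⟩
  exact (hX.isGaussian.hasGaussianLaw (Finset.univ.image ψ)).map_fun T

lemma aemeasurable_pi (hX : IsIsonormal X P) {κ : Type*} [Fintype κ] (ψ : κ → H) :
    AEMeasurable (fun ω i => X (ψ i) ω) P :=
  (hX.hasGaussianLaw_pi ψ).aemeasurable

lemma map_eq_gaussianReal (hX : IsIsonormal X P) {h : H} (hh : ‖h‖ = 1) :
    P.map (X h) = gaussianReal 0 1 := by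
  have hprob := hX.isGaussian.isProbabilityMeasure
  rw [(hX.isGaussian.hasGaussianLaw_eval h).map_eq_gaussianReal, hX.centered]
  congr
  rw [variance_of_integral_eq_zero (hX.isGaussian.aemeasurable h) (hX.centered h)]
  have : ∫ ω, X h ω * X h ω ∂P = 1 := by rw [hX.covariance, real_inner_self_eq_norm_sq, hh]; simp
  simp only [pow_two, this, Real.toNNReal_one]

/-- Subtracting the component along X h leaves a vector uncorrelated with X h, since X h has
variance ‖h‖² = 1. In a jointly Gaussian family, uncorrelated means independent. -/
lemma indepFun_sub_inner_mul (hX : IsIsonormal X P) {ι : Type*} [Fintype ι] (φ : ι → H) {h : H}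
    (hh : ‖h‖ = 1) :
    IndepFun (fun ω i => X (φ i) ω - ⟪φ i, h⟫_ℝ * X h ω) (X h) P := by
  have hprob := hX.isGaussian.isProbabilityMeasure
  let ψ : Option ι → H := fun o => o.elim h φ
  let T : (Option ι → ℝ) →L[ℝ] (ι → ℝ) × (Unit → ℝ) :=
    (ContinuousLinearMap.pi fun i => ContinuousLinearMap.proj (some i)
        - ⟪φ i, h⟫_ℝ • ContinuousLinearMap.proj none).prod
      (ContinuousLinearMap.pi fun _ => ContinuousLinearMap.proj none)
  have hlaw := (hX.hasGaussianLaw_pi ψ).map_fun T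
  have hind := HasGaussianLaw.indepFun_of_covariance_eval (ι := ι) (κ := Unit)
    (X := fun i ω => X (φ i) ω - ⟪φ i, h⟫_ℝ * X h ω) (Y := fun _ => X h) (P := P)
    (by convert! hlaw using 1) ?_
  · exact hind.comp (φ := id) (ψ := fun x => x ()) measurable_id
      (measurable_pi_apply (X := fun _ : Unit => ℝ) ())
  · intro i _
    have hmem : MemLp (fun ω => X (φ i) ω - ⟪φ i, h⟫_ℝ * X h ω) 2 P :=
      (hX.memLp _).sub ((hX.memLp h).const_mul _)
    rw [covariance_eq_sub hmem (hX.memLp h), hX.centered,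
      mul_zero, sub_zero]
    simp only [Pi.mul_apply, sub_mul, mul_assoc]
    have h1 : Integrable (fun ω => X (φ i) ω * X h ω) P := (hX.memLp _).integrable_mul (hX.memLp h)
    have h2 : Integrable (fun ω => X h ω * X h ω) P := (hX.memLp h).integrable_mul (hX.memLp h)
    rw [integral_sub h1 (h2.const_mul _), integral_const_mul, hX.covariance,
      hX.covariance, real_inner_self_eq_norm_sq, hh]
    simp

lemma memLp_hermite (hX : IsIsonormal X P) (h : H) (n : ℕ) :
    MemLp (fun ω => Polynomial.aeval (X h ω) (Polynomial.hermite n)) 2 P :=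
  memLp_aeval_of_hasGaussianLaw (hX.isGaussian.hasGaussianLaw_eval h) _

/-- Gaussian integration by parts for bounded cylindrical random variables. -/
lemma integral_fderiv_mul_hermite (hX : IsIsonormal X P) {ι : Type*} [Fintype ι] (φ : ι → H)
    {h : H} (hh : ‖h‖ = 1) {f : (ι → ℝ) → ℝ} {C : ℝ} (hf : ContDiff ℝ 1 f)
    (hC : ∀ x, |f x| ≤ C) (hC' : ∀ x, ‖fderiv ℝ f x‖ ≤ C) (n : ℕ) :
    ∫ ω, fderiv ℝ f (fun i => X (φ i) ω) (fun i => ⟪φ i, h⟫_ℝ)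
        * Polynomial.aeval (X h ω) (Polynomial.hermite n) ∂P
      = ∫ ω, f (fun i => X (φ i) ω)
        * Polynomial.aeval (X h ω) (Polynomial.hermite (n + 1)) ∂P := by
  have hprob := hX.isGaussian.isProbabilityMeasure
  -- The vector (X φᵢ) splits as Y + (X h) c with Y independent of X h. With Y frozen by Fubini,
  -- only the one-dimensional formula along the line y + x c remains.
  set c : ι → ℝ := fun i => ⟪φ i, h⟫_ℝ with hc
  set Y : Ω → ι → ℝ := fun ω i => X (φ i) ω - ⟪φ i, h⟫_ℝ * X h ω with hY
  have hXm := hX.isGaussian.aemeasurable h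
  have hYm : AEMeasurable Y P := aemeasurable_pi_lambda _ fun i =>
    (hX.isGaussian.aemeasurable (φ i)).sub (hXm.const_mul _)
  have hXY : ∀ ω, (fun i => X (φ i) ω) = Y ω + X h ω • c := by
    intro ω; ext i; simp [hY, hc]; ring
  have hmap : P.map (fun ω => (Y ω, X h ω)) = (P.map Y).prod (gaussianReal 0 1) := by
    rw [← hX.map_eq_gaussianReal hh]
    exact (indepFun_iff_map_prod_eq_prod_map_map hYm hXm).1 (hX.indepFun_sub_inner_mul φ hh)
  have hYprob : IsProbabilityMeasure (P.map Y) := Measure.isProbabilityMeasure_map hYm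
  have hfd : Continuous (fun x => fderiv ℝ f x c) :=
    (hf.continuous_fderiv one_ne_zero).clm_apply continuous_const
  have hadd : Continuous fun p : (ι → ℝ) × ℝ => p.1 + p.2 • c := by fun_prop
  have key : ∀ (G : (ι → ℝ) → ℝ) (D : ℝ) (m : ℕ), Continuous G → (∀ x, |G x| ≤ D) →
      ∫ ω, G (fun i => X (φ i) ω) * Polynomial.aeval (X h ω) (Polynomial.hermite m) ∂P
        = ∫ y, ∫ x, G (y + x • c) * Polynomial.aeval x (Polynomial.hermite m) ∂gaussianReal 0 1
          ∂P.map Y := by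
    intro G D m hG hGD
    have hcont : Continuous fun p : (ι → ℝ) × ℝ =>
        G (p.1 + p.2 • c) * Polynomial.aeval p.2 (Polynomial.hermite m) :=
      (hG.comp hadd).mul ((Polynomial.continuous_aeval _).comp continuous_snd)
    calc _ = ∫ ω, (fun p : (ι → ℝ) × ℝ =>
        G (p.1 + p.2 • c) * Polynomial.aeval p.2 (Polynomial.hermite m)) (Y ω, X h ω) ∂P := by
          simp only [hXY]
      _ = ∫ p, (fun p : (ι → ℝ) × ℝ =>
        G (p.1 + p.2 • c) * Polynomial.aeval p.2 (Polynomial.hermite m)) p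
          ∂(P.map Y).prod (gaussianReal 0 1) := by
          rw [← hmap, integral_map (hYm.prodMk hXm) hcont.aestronglyMeasurable]
      _ = _ := by
          rw [integral_prod]
          refine Integrable.bdd_mul ?_ (hG.comp hadd).aestronglyMeasurable
            (Filter.Eventually.of_forall fun p => hGD _)
          exact (integrable_hermite_gaussianReal m).comp_snd (P.map Y)
  rw [key (fun x => fderiv ℝ f x c) (C * ‖c‖) n hfd
    (fun x => ((fderiv ℝ f x).le_opNorm c).trans (by gcongr; exact hC' x)), key f C (n + 1)
    hf.continuous hC]
  congr 1
  ext y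
  refine integral_deriv_mul_hermite (C := max C (C * ‖c‖)) (f := fun x => f (y + x • c))
    (fun x => ?_) (fun x => (hC _).trans (le_max_left _ _))
    (fun x => le_trans (((fderiv ℝ f _).le_opNorm c).trans (by gcongr; exact hC' _))
      (le_max_right _ _)) n
  have h1 : HasDerivAt (fun x : ℝ => y + x • c) c x := by
    simpa using ((hasDerivAt_id x).smul_const c).const_add y
  exact ((hf.differentiable one_ne_zero).differentiableAt.hasFDerivAt
    (x := y + x • c)).comp_hasDerivAt x h1

end IsIsonormal

end Isonormal

/-! ### Dominated convergence in L² -/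

section L2

variable {Ω E : Type*} [NormedAddCommGroup E] [InnerProductSpace ℝ E] [MeasurableSpace Ω]
  {P : Measure Ω}

lemma norm_toLp_sub_sq {f g : Ω → E} (hf : MemLp f 2 P) (hg : MemLp g 2 P) :
    ‖hf.toLp f - hg.toLp g‖ ^ 2 = ∫ ω, ‖f ω - g ω‖ ^ 2 ∂P := by
  rw [← MemLp.toLp_sub, ← real_inner_self_eq_norm_sq, L2.inner_def]
  refine integral_congr_ae ?_
  filter_upwards [(hf.sub hg).coeFn_toLp] with ω hω
  rw [hω, real_inner_self_eq_norm_sq]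
  rfl

lemma tendsto_toLp_of_dominated {F : ℕ → Ω → E} {f : Ω → E} {b : Ω → ℝ}
    (hF : ∀ n, MemLp (F n) 2 P) (hf : MemLp f 2 P) (hb : MemLp b 2 P)
    (hbd : ∀ n, ∀ᵐ ω ∂P, ‖F n ω‖ ≤ b ω)
    (hlim : ∀ᵐ ω ∂P, Tendsto (fun n => F n ω) atTop (𝓝 (f ω))) :
    Tendsto (fun n => (hF n).toLp (F n)) atTop (𝓝 (hf.toLp f)) := by
  rw [tendsto_iff_norm_sub_tendsto_zero]
  have hsq : Tendsto (fun n => ‖(hF n).toLp (F n) - hf.toLp f‖ ^ 2) atTop (𝓝 0) := by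
    simp only [norm_toLp_sub_sq]
    have h0 : (0 : ℝ) = ∫ ω, (0 : ℝ) ∂P := by simp
    rw [h0]
    refine tendsto_integral_of_dominated_convergence (fun ω => (b ω + ‖f ω‖) ^ 2)
      (fun n => (((hF n).1.sub hf.1).norm.pow 2)) (hb.add hf.norm).integrable_sq
      (fun n => ?_) ?_
    · filter_upwards [hbd n] with ω hω
      rw [Real.norm_eq_abs, abs_of_nonneg (by positivity)]
      gcongr
      exact (norm_sub_le _ _).trans (by gcongr)
    · filter_upwards [hlim] with ω hω
      have := (tendsto_iff_norm_sub_tendsto_zero.1 hω).pow 2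
      simpa using this
  have := hsq.sqrt
  simpa [Real.sqrt_sq] using this

end L2

/-! ### Cylindrical random variables and the closed graph of the derivative -/

section Cylinder

variable {Ω H : Type*} [NormedAddCommGroup H] [InnerProductSpace ℝ H] [MeasurableSpace Ω]
  {X : H → Ω → ℝ} {P : Measure Ω}

/-- The value of the Malliavin derivative of a cylindrical random variable as a function of the
underlying Gaussian vector. -/
noncomputable def cylDeriv {ι : Type*} [Fintype ι] [DecidableEq ι] (φ : ι → H) (f : (ι → ℝ) → ℝ)
    (x : ι → ℝ) : H :=
  ∑ i, fderiv ℝ f x (Pi.single i 1) • φ i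

section

variable {ι κ : Type*} [Fintype ι] [Fintype κ]

lemma exists_bound_of_hasCompactSupport {f : (ι → ℝ) → ℝ} (hf : ContDiff ℝ 1 f)
    (hc : HasCompactSupport f) : ∃ C, (∀ x, |f x| ≤ C) ∧ ∀ x, ‖fderiv ℝ f x‖ ≤ C := by
  obtain ⟨A, hA⟩ := hc.exists_bound_of_continuous hf.continuous
  obtain ⟨B, hB⟩ := (hc.fderiv ℝ).exists_bound_of_continuous (hf.continuous_fderiv one_ne_zero)
  exact ⟨max A B, fun x => (hA x).trans (le_max_left _ _), fun x => (hB x).trans (le_max_right _ _)⟩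

namespace IsIsonormal

lemma aestronglyMeasurable_comp (hX : IsIsonormal X P) (φ : ι → H) {E : Type*}
    [TopologicalSpace E] {f : (ι → ℝ) → E} (hf : Continuous f) :
    AEStronglyMeasurable (fun ω => f (fun i => X (φ i) ω)) P :=
  hf.comp_aestronglyMeasurable (hX.aemeasurable_pi φ).aestronglyMeasurable

lemma memLp_comp_of_bound (hX : IsIsonormal X P) (φ : ι → H) {E : Type*}
    [NormedAddCommGroup E] {f : (ι → ℝ) → E} (hf : Continuous f) {C : ℝ} (hC : ∀ x, ‖f x‖ ≤ C) :
    MemLp (fun ω => f (fun i => X (φ i) ω)) 2 P := by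
  have hprob := hX.isGaussian.isProbabilityMeasure
  exact MemLp.of_bound (hX.aestronglyMeasurable_comp φ hf) C (Eventually.of_forall fun _ => hC _)

end IsIsonormal

variable [DecidableEq ι] [DecidableEq κ]

/-- Testing against h turns the H-valued derivative into a directional derivative of f. The calculus
rules below are thus inherited from `fderiv` by `ext_inner_right`. -/
lemma inner_cylDeriv (φ : ι → H) (f : (ι → ℝ) → ℝ) (x : ι → ℝ) (h : H) :
    ⟪cylDeriv φ f x, h⟫_ℝ = fderiv ℝ f x (fun i => ⟪φ i, h⟫_ℝ) := by
  rw [cylDeriv, sum_inner, ← Finset.univ_sum_single (fun i => ⟪φ i, h⟫_ℝ), map_sum]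
  refine Finset.sum_congr rfl fun i _ => ?_
  rw [real_inner_smul_left]
  have : (Pi.single i ⟪φ i, h⟫_ℝ : ι → ℝ) = ⟪φ i, h⟫_ℝ • Pi.single i 1 := by
    rw [← Pi.single_smul]; simp
  rw [this, map_smul, smul_eq_mul, mul_comm]

lemma norm_cylDeriv_le (φ : ι → H) (f : (ι → ℝ) → ℝ) (x : ι → ℝ) :
    ‖cylDeriv φ f x‖ ≤ (∑ i, ‖φ i‖) * ‖fderiv ℝ f x‖ := by
  rw [cylDeriv, Finset.sum_mul]
  refine (norm_sum_le _ _).trans (Finset.sum_le_sum fun i _ => ?_)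
  rw [norm_smul, mul_comm]
  gcongr
  refine ((fderiv ℝ f x).le_opNorm _).trans ?_
  rw [Pi.norm_single, norm_one, mul_one]

lemma continuous_cylDeriv (φ : ι → H) {f : (ι → ℝ) → ℝ} (hf : ContDiff ℝ 1 f) :
    Continuous (cylDeriv φ f) :=
  continuous_finsetSum _ fun _ _ =>
    ((hf.continuous_fderiv one_ne_zero).clm_apply continuous_const).smul continuous_const

lemma cylDeriv_add (φ : ι → H) {f g : (ι → ℝ) → ℝ} (hf : Differentiable ℝ f)
    (hg : Differentiable ℝ g) (x : ι → ℝ) :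
    cylDeriv φ (fun y => f y + g y) x = cylDeriv φ f x + cylDeriv φ g x := by
  refine ext_inner_right ℝ fun h => ?_
  rw [inner_add_left, inner_cylDeriv, inner_cylDeriv, inner_cylDeriv, fderiv_fun_add (hf x) (hg x)]
  rfl

lemma cylDeriv_mul (φ : ι → H) {f g : (ι → ℝ) → ℝ} (hf : Differentiable ℝ f)
    (hg : Differentiable ℝ g) (x : ι → ℝ) :
    cylDeriv φ (fun y => f y * g y) x = f x • cylDeriv φ g x + g x • cylDeriv φ f x := by
  refine ext_inner_right ℝ fun h => ?_
  rw [inner_add_left, real_inner_smul_left, real_inner_smul_left, inner_cylDeriv, inner_cylDeriv,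
    inner_cylDeriv, fderiv_fun_mul (hf x) (hg x)]
  rfl

lemma cylDeriv_comp (φ : ι → H) {u : ℝ → ℝ} {f : (ι → ℝ) → ℝ} (hu : Differentiable ℝ u)
    (hf : Differentiable ℝ f) (x : ι → ℝ) :
    cylDeriv φ (fun y => u (f y)) x = _root_.deriv u (f x) • cylDeriv φ f x := by
  refine ext_inner_right ℝ fun h => ?_
  rw [real_inner_smul_left, inner_cylDeriv, inner_cylDeriv]
  have := ((hu (f x)).hasDerivAt.comp_hasFDerivAt x (hf x).hasFDerivAt).fderiv
  rw [Function.comp_def] at this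
  rw [this]
  rfl

lemma cylDeriv_reindex (φ : κ → H) (e : ι → κ) {f : (ι → ℝ) → ℝ} (hf : Differentiable ℝ f)
    (x : κ → ℝ) :
    cylDeriv φ (fun y => f (fun i => y (e i))) x
      = cylDeriv (fun i => φ (e i)) f (fun i => x (e i)) := by
  refine ext_inner_right ℝ fun h => ?_
  rw [inner_cylDeriv, inner_cylDeriv]
  let T : (κ → ℝ) →L[ℝ] (ι → ℝ) := ContinuousLinearMap.pi fun i => ContinuousLinearMap.proj (e i)
  have h1 := ((hf (T x)).hasFDerivAt.comp x T.hasFDerivAt).fderiv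
  have h2 : (fun y : κ → ℝ => f (fun i => y (e i))) = f ∘ T := rfl
  rw [h2, h1]
  rfl

namespace IsIsonormal

lemma memLp_cylDeriv_of_bound (hX : IsIsonormal X P) (φ : ι → H) {f : (ι → ℝ) → ℝ}
    (hf : ContDiff ℝ 1 f) {C : ℝ} (hC : ∀ x, ‖fderiv ℝ f x‖ ≤ C) :
    MemLp (fun ω => cylDeriv φ f (fun i => X (φ i) ω)) 2 P :=
  hX.memLp_comp_of_bound φ (continuous_cylDeriv φ hf) fun x =>
    (norm_cylDeriv_le φ f x).trans (mul_le_mul_of_nonneg_left (hC x) (by positivity))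

end IsIsonormal

end

namespace IsIsonormal

/-- Elements of `smoothGraph` in terms of bounded smooth functions. -/
lemma exists_of_mem_smoothGraph (hX : IsIsonormal X P) {p : Lp ℝ 2 P × Lp H 2 P}
    (hp : p ∈ smoothGraph X P) :
    ∃ (n : ℕ) (φ : Fin n → H) (f : (Fin n → ℝ) → ℝ) (C : ℝ), 1 ≤ n ∧ ContDiff ℝ (⊤ : ℕ∞) f ∧
      HasCompactSupport f ∧ (∀ x, |f x| ≤ C) ∧ (∀ x, ‖fderiv ℝ f x‖ ≤ C) ∧
      ∃ (h1 : MemLp (fun ω => f (fun i => X (φ i) ω)) 2 P)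
        (h2 : MemLp (fun ω => cylDeriv φ f (fun i => X (φ i) ω)) 2 P),
        p = (h1.toLp _, h2.toLp _) := by
  obtain ⟨n, φ, f, hn, hf, hc, h1, h2⟩ := hp
  have hf1 : ContDiff ℝ 1 f := hf.of_le (by exact_mod_cast le_top)
  obtain ⟨C, hC, hC'⟩ := exists_bound_of_hasCompactSupport hf1 hc
  have m1 := hX.memLp_comp_of_bound φ hf.continuous hC
  have m2 := hX.memLp_cylDeriv_of_bound φ hf1 hC'
  refine ⟨n, φ, f, C, hn, hf, hc, hC, hC', m1, m2, Prod.ext ?_ ?_⟩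
  · exact Lp.ext (h1.trans m1.coeFn_toLp.symm)
  · exact Lp.ext (h2.trans m2.coeFn_toLp.symm)

lemma mem_smoothGraph {n : ℕ} (hn : 1 ≤ n) (φ : Fin n → H)
    {f : (Fin n → ℝ) → ℝ} (hf : ContDiff ℝ (⊤ : ℕ∞) f) (hc : HasCompactSupport f)
    (h1 : MemLp (fun ω => f (fun i => X (φ i) ω)) 2 P)
    (h2 : MemLp (fun ω => cylDeriv φ f (fun i => X (φ i) ω)) 2 P) :
    (h1.toLp _, h2.toLp _) ∈ smoothGraph X P :=
  ⟨n, φ, f, hn, hf, hc, h1.coeFn_toLp, h2.coeFn_toLp⟩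

/-- Smooth functions of a Gaussian vector that are square integrable together with their derivative
belong to the domain of the Malliavin derivative, without any condition on the support. -/
lemma mem_closure_smoothGraph (hX : IsIsonormal X P) {n : ℕ} (hn : 1 ≤ n) (φ : Fin n → H)
    {f : (Fin n → ℝ) → ℝ} (hf : ContDiff ℝ (⊤ : ℕ∞) f)
    (h1 : MemLp (fun ω => f (fun i => X (φ i) ω)) 2 P)
    (h2 : MemLp (fun ω => cylDeriv φ f (fun i => X (φ i) ω)) 2 P) :
    (h1.toLp _, h2.toLp _) ∈ closure (smoothGraph X P) := by
  -- Truncation by χ(x/(N+1)): the cutoffs tend to 1 pointwise, and their derivatives are O(1/N), so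
  -- the product rule creates no extra term in the limit.
  let χ : ContDiffBump (0 : Fin n → ℝ) := ⟨1, 2, by norm_num, by norm_num⟩
  have hχ : ContDiff ℝ (⊤ : ℕ∞) χ := χ.contDiff
  obtain ⟨C, -, hC⟩ := exists_bound_of_hasCompactSupport
    (hχ.of_le (by exact_mod_cast le_top)) χ.hasCompactSupport
  have hC0 : 0 ≤ C := (norm_nonneg _).trans (hC 0)
  let r : ℕ → ℝ := fun N => ((N : ℝ) + 1)⁻¹
  have hr : ∀ N, 0 < r N := fun N => by positivity
  have hr1 : ∀ N, r N ≤ 1 := fun N => inv_le_one_of_one_le₀ (by linarith [N.cast_nonneg (α := ℝ)])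
  have hrlim : Tendsto r atTop (𝓝 0) := by
    simpa [r, one_div] using tendsto_one_div_add_atTop_nhds_zero_nat (𝕜 := ℝ)
  let c : ℕ → (Fin n → ℝ) → ℝ := fun N x => χ (r N • x)
  have hcs : ∀ N, ContDiff ℝ (⊤ : ℕ∞) (c N) := fun N => hχ.comp (contDiff_const_smul _)
  have hcd : ∀ N, Differentiable ℝ (c N) := fun N => (hcs N).differentiable (by simp)
  have hfd : Differentiable ℝ f := hf.differentiable (by simp)
  have hcc : ∀ N, HasCompactSupport (c N) := fun N =>
    χ.hasCompactSupport.comp_smul (hr N).ne'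
  have hc1 : ∀ N x, |c N x| ≤ 1 := fun N x => by
    rw [abs_of_nonneg χ.nonneg]; exact χ.le_one
  have hcf : ∀ N x, ‖fderiv ℝ (c N) x‖ ≤ r N * C := by
    intro N x
    have : fderiv ℝ (c N) x = r N • fderiv ℝ χ (r N • x) := fderiv_comp_smul _
    rw [this, norm_smul, Real.norm_of_nonneg (hr N).le]
    exact mul_le_mul_of_nonneg_left (hC _) (hr N).le
  have hclim : ∀ x, Tendsto (fun N => c N x) atTop (𝓝 1) := by
    intro x
    have h0 : Tendsto (fun N => r N • x) atTop (𝓝 0) := by simpa using hrlim.smul_const x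
    have := (χ.continuous.tendsto 0).comp h0
    rwa [χ.one_of_mem_closedBall (Metric.mem_closedBall_self χ.rIn_pos.le)] at this
  have hD : ∀ N x, cylDeriv φ (fun y => c N y * f y) x
      = c N x • cylDeriv φ f x + f x • cylDeriv φ (c N) x := fun N x => cylDeriv_mul φ (hcd N) hfd x
  set S : ℝ := ∑ i, ‖φ i‖ with hS
  have hS0 : 0 ≤ S := by positivity
  have hDc : ∀ N x, ‖cylDeriv φ (c N) x‖ ≤ S * (r N * C) := fun N x =>
    (norm_cylDeriv_le _ _ _).trans (by gcongr; exact hcf N x)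
  have hsm : ∀ N, ContDiff ℝ (⊤ : ℕ∞) (fun y => c N y * f y) := fun N => (hcs N).mul hf
  have hb1 : ∀ N x, ‖c N x * f x‖ ≤ ‖f x‖ := fun N x => by
    rw [norm_mul]; exact mul_le_of_le_one_left (norm_nonneg _) (hc1 N x)
  have hb2 : ∀ N x, ‖cylDeriv φ (fun y => c N y * f y) x‖ ≤ ‖cylDeriv φ f x‖ + S * C * ‖f x‖ := by
    intro N x
    rw [hD]
    refine (norm_add_le _ _).trans ?_
    rw [norm_smul, norm_smul]
    refine add_le_add (mul_le_of_le_one_left (norm_nonneg _) (hc1 N x)) ?_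
    rw [mul_comm]
    gcongr
    refine (hDc N x).trans ?_
    gcongr
    exact mul_le_of_le_one_left hC0 (hr1 N)
  have hdom : MemLp (fun ω => ‖cylDeriv φ f (fun i => X (φ i) ω)‖
      + S * C * ‖f (fun i => X (φ i) ω)‖) 2 P := h2.norm.add (h1.norm.const_mul _)
  have m1 : ∀ N, MemLp (fun ω => (fun y => c N y * f y) (fun i => X (φ i) ω)) 2 P := fun N =>
    h1.mono (hX.aestronglyMeasurable_comp φ (hsm N).continuous)
      (Eventually.of_forall fun ω => hb1 N _)
  have m2 : ∀ N, MemLp (fun ω => cylDeriv φ (fun y => c N y * f y) (fun i => X (φ i) ω)) 2 P :=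
    fun N => hdom.mono (hX.aestronglyMeasurable_comp φ (continuous_cylDeriv φ
      ((hsm N).of_le (by exact_mod_cast le_top))))
      (Eventually.of_forall fun ω => (hb2 N _).trans (le_abs_self _))
  refine mem_closure_of_tendsto (f := fun N => ((m1 N).toLp _, (m2 N).toLp _)) (b := atTop) ?_
    (Eventually.of_forall fun N => mem_smoothGraph hn φ (hsm N) ((hcc N).mul_right) _ _)
  refine Tendsto.prodMk_nhds ?_ ?_
  · refine tendsto_toLp_of_dominated m1 h1 h1.norm
      (fun N => Eventually.of_forall fun ω => hb1 N _) (Eventually.of_forall fun ω => ?_)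
    simpa using (hclim (fun i => X (φ i) ω)).mul_const (f (fun i => X (φ i) ω))
  · refine tendsto_toLp_of_dominated m2 h2 hdom
      (fun N => Eventually.of_forall fun ω => hb2 N _) (Eventually.of_forall fun ω => ?_)
    simp only [hD]
    have h0 : Tendsto (fun N => cylDeriv φ (c N) (fun i => X (φ i) ω)) atTop (𝓝 0) := by
      refine squeeze_zero_norm (fun N => hDc N _) ?_
      simpa using (hrlim.mul_const C).const_mul S
    simpa using ((hclim (fun i => X (φ i) ω)).smul_const (cylDeriv φ f (fun i => X (φ i) ω))).add
      (h0.const_smul (f (fun i => X (φ i) ω)))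

/-- Written on the concatenated Gaussian vector, the sum is f(x) + g(y), which in general is not
compactly supported. It is therefore only placed in the closure, by `mem_closure_smoothGraph`. -/
lemma add_mem_closure_smoothGraph (hX : IsIsonormal X P) {p q : Lp ℝ 2 P × Lp H 2 P}
    (hp : p ∈ smoothGraph X P) (hq : q ∈ smoothGraph X P) :
    p + q ∈ closure (smoothGraph X P) := by
  obtain ⟨n, φ, f, C, hn, hf, -, hC, hC', p1, p2, rfl⟩ := hX.exists_of_mem_smoothGraph hp
  obtain ⟨k, ψ, g, D, hk, hg, -, hD, hD', q1, q2, rfl⟩ := hX.exists_of_mem_smoothGraph hq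
  let F : (Fin (n + k) → ℝ) → ℝ := fun x =>
    f (fun i => x (Fin.castAdd k i)) + g (fun i => x (Fin.natAdd n i))
  have hf' : ContDiff ℝ (⊤ : ℕ∞) (fun x : Fin (n + k) → ℝ => f (fun i => x (Fin.castAdd k i))) :=
    hf.comp (contDiff_pi.2 fun i => contDiff_apply _ _ _)
  have hg' : ContDiff ℝ (⊤ : ℕ∞) (fun x : Fin (n + k) → ℝ => g (fun i => x (Fin.natAdd n i))) :=
    hg.comp (contDiff_pi.2 fun i => contDiff_apply _ _ _)
  have hF : ContDiff ℝ (⊤ : ℕ∞) F := hf'.add hg'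
  have e1 : ∀ ω, F (fun i => X (Fin.append φ ψ i) ω)
      = f (fun i => X (φ i) ω) + g (fun i => X (ψ i) ω) := fun ω => by
    simp [F, Fin.append_left, Fin.append_right]
  have e2 : ∀ ω, cylDeriv (Fin.append φ ψ) F (fun i => X (Fin.append φ ψ i) ω)
      = cylDeriv φ f (fun i => X (φ i) ω) + cylDeriv ψ g (fun i => X (ψ i) ω) := fun ω => by
    rw [cylDeriv_add _ (hf'.differentiable (by simp)) (hg'.differentiable (by simp)),
      cylDeriv_reindex _ _ (hf.differentiable (by simp)),
      cylDeriv_reindex _ _ (hg.differentiable (by simp))]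
    simp [Fin.append_left, Fin.append_right]
  have r1 : MemLp (fun ω => F (fun i => X (Fin.append φ ψ i) ω)) 2 P := by
    simp only [e1]; exact p1.add q1
  have r2 : MemLp (fun ω => cylDeriv (Fin.append φ ψ) F (fun i => X (Fin.append φ ψ i) ω)) 2 P := by
    simp only [e2]; exact p2.add q2
  convert! hX.mem_closure_smoothGraph (by omega) (Fin.append φ ψ) hF r1 r2 using 1
  refine Prod.ext ?_ ?_
  · simp only [e1]; rfl
  · simp only [e2]; rfl

lemma smul_mem_smoothGraph (c : ℝ) {p : Lp ℝ 2 P × Lp H 2 P}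
    (hp : p ∈ smoothGraph X P) : c • p ∈ smoothGraph X P := by
  obtain ⟨n, φ, f, hn, hf, hc, h1, h2⟩ := hp
  refine ⟨n, φ, fun x => c * f x, hn, contDiff_const.mul hf, hc.mul_left, ?_, ?_⟩
  · filter_upwards [Lp.coeFn_smul c p.1, h1] with ω a b
    simp only [Prod.smul_fst, a, Pi.smul_apply, b, smul_eq_mul]
  · filter_upwards [Lp.coeFn_smul c p.2, h2] with ω a b
    simp only [Prod.smul_snd, a, Pi.smul_apply, b]
    rw [fderiv_const_mul (hf.differentiable (by simp) _), Finset.smul_sum]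
    simp [smul_smul]

/-- The graph of the Malliavin derivative, as a subspace. -/
noncomputable def derivGraph (hX : IsIsonormal X P) : Submodule ℝ (Lp ℝ 2 P × Lp H 2 P) where
  carrier := closure (smoothGraph X P)
  add_mem' ha hb := by
    have := map_mem_closure₂ continuous_add ha hb (u := closure (smoothGraph X P))
      fun a ha b hb => hX.add_mem_closure_smoothGraph ha hb
    rwa [closure_closure] at this
  zero_mem' := by
    refine subset_closure ⟨1, fun _ => 0, fun _ => 0, le_rfl, contDiff_const, ?_, ?_, ?_⟩
    · exact HasCompactSupport.zero
    · exact Lp.coeFn_zero _ _ _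
    · filter_upwards [Lp.coeFn_zero H 2 P] with ω hω
      simp only [Prod.snd_zero, hω]
      simp
  smul_mem' c p hp := map_mem_closure (continuous_const_smul c) hp
    fun _ h => smul_mem_smoothGraph c h

lemma isClosed_derivGraph (hX : IsIsonormal X P) :
    IsClosed (hX.derivGraph : Set (Lp ℝ 2 P × Lp H 2 P)) := isClosed_closure

end IsIsonormal

end Cylinder

/-! ### Spectral theory of D* D for a closed linear relation -/

section Hilbert

variable {E K : Type*} [NormedAddCommGroup E] [InnerProductSpace ℝ E]
  [NormedAddCommGroup K] [InnerProductSpace ℝ K]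

lemma summable_iff_of_pairwise_inner_eq_zero [CompleteSpace E] {f : ℕ → E}
    (hf : ∀ i j, i ≠ j → ⟪f i, f j⟫_ℝ = 0) : Summable f ↔ Summable fun i => ‖f i‖ ^ 2 := by
  have hV : OrthogonalFamily ℝ (fun i => Submodule.span ℝ {f i})
      (fun i => (Submodule.span ℝ {f i}).subtypeₗᵢ) := by
    refine OrthogonalFamily.of_pairwise fun i j hij => ?_
    rw [Function.onFun, Submodule.isOrtho_span]
    rintro u rfl v rfl
    exact hf i j hij
  exact hV.summable_iff_norm_sq_summable fun i => ⟨f i, Submodule.mem_span_singleton_self _⟩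

/-- For a linear relation `G` between Hilbert spaces (the graph of a densely defined operator `D`),
the graph of the restriction of `D` to the eigenspace of `D* D` for the eigenvalue `c`. -/
def eigenGraph (G : Submodule ℝ (E × K)) (c : ℝ) : Submodule ℝ (E × K) where
  carrier := {p | p ∈ G ∧ ∀ q ∈ G, ⟪q.2, p.2⟫_ℝ = c * ⟪q.1, p.1⟫_ℝ}
  add_mem' ha hb := ⟨G.add_mem ha.1 hb.1, fun q hq => by
    simp [inner_add_right, ha.2 q hq, hb.2 q hq, mul_add]⟩
  zero_mem' := ⟨G.zero_mem, fun q _ => by simp⟩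
  smul_mem' r p hp := ⟨G.smul_mem r hp.1, fun q hq => by
    simp only [Prod.smul_fst, Prod.smul_snd, real_inner_smul_right, hp.2 q hq]; ring⟩

lemma mem_eigenGraph {G : Submodule ℝ (E × K)} {c : ℝ} {p : E × K} :
    p ∈ eigenGraph G c ↔ p ∈ G ∧ ∀ q ∈ G, ⟪q.2, p.2⟫_ℝ = c * ⟪q.1, p.1⟫_ℝ := Iff.rfl

lemma norm_sq_of_mem_eigenGraph {G : Submodule ℝ (E × K)} {c : ℝ} {p : E × K}
    (hp : p ∈ eigenGraph G c) : ‖p.2‖ ^ 2 = c * ‖p.1‖ ^ 2 := by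
  rw [← real_inner_self_eq_norm_sq, ← real_inner_self_eq_norm_sq]
  exact hp.2 p hp.1

/-- The eigenspace of `D* D` for the eigenvalue `c`. -/
def eigenspace (G : Submodule ℝ (E × K)) (c : ℝ) : Submodule ℝ E :=
  (eigenGraph G c).map (LinearMap.fst ℝ E K)

lemma mem_eigenspace {G : Submodule ℝ (E × K)} {c : ℝ} {F : E} :
    F ∈ eigenspace G c ↔ ∃ U, (F, U) ∈ eigenGraph G c := by
  simp [eigenspace]

lemma isClosed_eigenGraph {G : Submodule ℝ (E × K)} (hG : IsClosed (G : Set (E × K))) (c : ℝ) :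
    IsClosed (eigenGraph G c : Set (E × K)) := by
  have : (eigenGraph G c : Set (E × K))
      = (G : Set (E × K)) ∩ ⋂ q ∈ G, {p : E × K | ⟪q.2, p.2⟫_ℝ = c * ⟪q.1, p.1⟫_ℝ} := by
    ext p; simp [mem_eigenGraph]
  rw [this]
  exact hG.inter (isClosed_biInter fun q _ => isClosed_eq (by fun_prop) (by fun_prop))

/-- On an eigenvector, ‖DF‖² = c‖F‖², so the first projection is bounded below on the closed
eigengraph and has closed range. -/
lemma isClosed_eigenspace [CompleteSpace E] [CompleteSpace K] {G : Submodule ℝ (E × K)}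
    (hG : IsClosed (G : Set (E × K))) {c : ℝ} (hc : 0 ≤ c) :
    IsClosed (eigenspace G c : Set E) := by
  have hcomp : CompleteSpace (eigenGraph G c) :=
    (isClosed_eigenGraph hG c).completeSpace_coe
  let T : eigenGraph G c →L[ℝ] E :=
    (ContinuousLinearMap.fst ℝ E K).comp (eigenGraph G c).subtypeL
  -- The norm on the product is the maximum of ‖F‖ and √c ‖F‖; the constant 1 + c dominates both
  -- factors without a square root.
  have hT : AntilipschitzWith (Real.toNNReal (1 + c)) T := by
    refine ContinuousLinearMap.antilipschitz_of_bound _ fun p => ?_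
    rw [Real.coe_toNNReal _ (by positivity)]
    have h := norm_sq_of_mem_eigenGraph p.2
    change ‖(p : E × K)‖ ≤ (1 + c) * ‖(p : E × K).1‖
    have h0 := norm_nonneg (p : E × K).1
    rw [Prod.norm_def]
    refine max_le ?_ (abs_le_of_sq_le_sq' ?_ (by positivity)).2
    · nlinarith
    · rw [h]; nlinarith [mul_nonneg hc (sq_nonneg ‖(p : E × K).1‖), mul_nonneg (mul_nonneg hc hc)
        (sq_nonneg ‖(p : E × K).1‖), sq_nonneg ‖(p : E × K).1‖]
  have h := hT.isClosed_range T.uniformContinuous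
  convert h using 1
  ext F
  simp [mem_eigenspace, T]

variable {G : Submodule ℝ (E × K)} {V : ℕ → Submodule ℝ E}

/-- Symmetry of D*D: ⟪U, U'⟫ equals both i⟪F, F'⟫ and j⟪F, F'⟫. -/
lemma inner_eq_zero_of_mem_eigenspace (hV : ∀ m, V m ≤ eigenspace G m) {i j : ℕ} (hij : i ≠ j)
    {F F' : E} (hF : F ∈ V i) (hF' : F' ∈ V j) : ⟪F, F'⟫_ℝ = 0 := by
  obtain ⟨U, hU⟩ := mem_eigenspace.1 (hV i hF)
  obtain ⟨U', hU'⟩ := mem_eigenspace.1 (hV j hF')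
  have h1 := hU.2 _ hU'.1
  have h2 := hU'.2 _ hU.1
  simp only at h1 h2
  rw [real_inner_comm, h2, real_inner_comm] at h1
  have : ((j : ℝ) - i) * ⟪F, F'⟫_ℝ = 0 := by rw [real_inner_comm]; linarith
  exact (mul_eq_zero.1 this).resolve_left fun h => hij.symm (by exact_mod_cast sub_eq_zero.1 h)

/-- Dividing by the eigenvalue m + 1 makes D* send the m-th derivative term back to `J m`. The
derivative terms are orthogonal with squared norms ‖J m‖²/(m+1), hence summable, and closedness of
the graph lets D pass through the sum. -/
lemma exists_deriv_tsum_of_eigenGraph [CompleteSpace E] [CompleteSpace K]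
    (hG : IsClosed (G : Set (E × K))) {J : ℕ → E} {U : ℕ → K}
    (hU : ∀ m, (J m, U m) ∈ eigenGraph G ((m + 1 : ℕ) : ℝ))
    (hJo : ∀ i j, i ≠ j → ⟪J i, J j⟫_ℝ = 0) (hJsum : Summable J) :
    ∃ W, (∑' m : ℕ, (1 / ((m + 1 : ℕ) : ℝ)) • J m, W) ∈ G ∧
      ∀ q ∈ G, ⟪q.2, W⟫_ℝ = ⟪q.1, ∑' m : ℕ, J m⟫_ℝ := by
  set r : ℕ → ℝ := fun m => 1 / ((m + 1 : ℕ) : ℝ) with hr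
  have hr0 : ∀ m, 0 < r m := fun m => by positivity
  have hr1 : ∀ m, r m ≤ 1 := fun m => by
    rw [hr]; exact div_le_one_of_le₀ (by norm_cast; omega) (by positivity)
  have hrm : ∀ m, r m * ((m + 1 : ℕ) : ℝ) = 1 := fun m => by rw [hr]; field_simp
  have hJs : Summable fun m => ‖J m‖ ^ 2 := (summable_iff_of_pairwise_inner_eq_zero hJo).1 hJsum
  have hmem : ∀ m, (r m • J m, r m • U m) ∈ G := fun m => G.smul_mem (r m) (hU m).1
  have hinner : ∀ m, ∀ q ∈ G, ⟪q.2, r m • U m⟫_ℝ = ⟪q.1, J m⟫_ℝ := fun m q hq => by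
    rw [real_inner_smul_right, (hU m).2 q hq, ← mul_assoc, hrm, one_mul]
  have s1 : Summable fun m => r m • J m := by
    refine (summable_iff_of_pairwise_inner_eq_zero fun i j hij => ?_).2
      (hJs.of_nonneg_of_le (fun _ => by positivity) fun m => ?_)
    · rw [real_inner_smul_left, real_inner_smul_right, hJo i j hij]; simp
    · rw [norm_smul, Real.norm_of_nonneg (hr0 m).le, mul_pow]
      exact mul_le_of_le_one_left (by positivity) (pow_le_one₀ (hr0 m).le (hr1 m))
  have s2 : Summable fun m => r m • U m := by
    refine (summable_iff_of_pairwise_inner_eq_zero fun i j hij => ?_).2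
      (hJs.of_nonneg_of_le (fun _ => by positivity) fun m => ?_)
    · rw [hinner j _ (hmem i), real_inner_smul_left, hJo i j hij, mul_zero]
    · rw [← real_inner_self_eq_norm_sq, hinner m _ (hmem m), real_inner_smul_left,
        real_inner_self_eq_norm_sq]
      exact mul_le_of_le_one_left (by positivity) (hr1 m)
  refine ⟨∑' m, r m • U m, ?_, fun q hq => ?_⟩
  · refine hG.mem_of_tendsto (b := atTop) (s1.hasSum.prodMk s2.hasSum)
      (Eventually.of_forall fun s => ?_)
    exact G.sum_mem fun m _ => hmem m
  · have h1 := s2.hasSum.mapL (innerSL ℝ q.2)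
    have h2 := hJsum.hasSum.mapL (innerSL ℝ q.1)
    simp only [innerSL_apply_apply] at h1 h2
    simp only [hinner _ q hq] at h1
    exact h1.unique h2

variable [∀ m, CompleteSpace (V m)]

lemma inner_starProjection_eq_zero (hV : ∀ m, V m ≤ eigenspace G m) (Z : E) {i j : ℕ}
    (hij : i ≠ j) : ⟪(V i).starProjection Z, (V j).starProjection Z⟫_ℝ = 0 :=
  inner_eq_zero_of_mem_eigenspace hV hij ((V i).starProjection_apply_mem Z)
    ((V j).starProjection_apply_mem Z)

lemma inner_starProjection_of_mem {m : ℕ} {F : E} (hF : F ∈ V m) (Z : E) :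
    ⟪F, (V m).starProjection Z⟫_ℝ = ⟪F, Z⟫_ℝ := by
  have := (V m).starProjection_inner_eq_zero Z F hF
  rw [inner_sub_left, sub_eq_zero, real_inner_comm, real_inner_comm F] at this
  exact this.symm

/-- Bessel's inequality for the mutually orthogonal spaces V m. -/
lemma summable_norm_sq_starProjection (hV : ∀ m, V m ≤ eigenspace G m) (Z : E) :
    Summable fun m => ‖(V m).starProjection Z‖ ^ 2 := by
  refine summable_of_sum_le (c := ‖Z‖ ^ 2) (fun _ => by positivity) fun s => ?_
  have h1 : ⟪∑ m ∈ s, (V m).starProjection Z, Z⟫_ℝ = ∑ m ∈ s, ‖(V m).starProjection Z‖ ^ 2 := by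
    rw [sum_inner]
    refine Finset.sum_congr rfl fun m _ => ?_
    rw [← inner_starProjection_of_mem ((V m).starProjection_apply_mem Z),
      real_inner_self_eq_norm_sq]
  have h2 : ‖∑ m ∈ s, (V m).starProjection Z‖ ^ 2 = ∑ m ∈ s, ‖(V m).starProjection Z‖ ^ 2 := by
    rw [← real_inner_self_eq_norm_sq, sum_inner]
    refine Finset.sum_congr rfl fun m hm => ?_
    rw [inner_sum, Finset.sum_eq_single_of_mem m hm fun k _ hk =>
      inner_starProjection_eq_zero hV Z hk.symm, real_inner_self_eq_norm_sq]
  have h3 := real_inner_le_norm (∑ m ∈ s, (V m).starProjection Z) Z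
  rw [h1, ← h2] at h3
  rw [← h2]
  nlinarith [norm_nonneg (∑ m ∈ s, (V m).starProjection Z), norm_nonneg Z,
    sq_nonneg (‖∑ m ∈ s, (V m).starProjection Z‖ - ‖Z‖)]

variable [CompleteSpace E]

lemma summable_starProjection (hV : ∀ m, V m ≤ eigenspace G m) (Z : E) :
    Summable fun m => (V m).starProjection Z :=
  (summable_iff_of_pairwise_inner_eq_zero fun _ _ => inner_starProjection_eq_zero hV Z).2
    (summable_norm_sq_starProjection hV Z)

lemma inner_sub_tsum_starProjection (hV : ∀ m, V m ≤ eigenspace G m) (Z : E) {m : ℕ} {F : E}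
    (hF : F ∈ V m) : ⟪F, Z - ∑' k, (V k).starProjection Z⟫_ℝ = 0 := by
  have h := (summable_starProjection hV Z).hasSum.mapL (innerSL ℝ F)
  have h' : HasSum (fun k => ⟪F, (V k).starProjection Z⟫_ℝ) ⟪F, Z⟫_ℝ := by
    rw [← inner_starProjection_of_mem hF]
    exact hasSum_single m fun k hk =>
      inner_eq_zero_of_mem_eigenspace hV hk.symm hF ((V k).starProjection_apply_mem Z)
  rw [inner_sub_right, sub_eq_zero]
  exact h'.unique h

/-- The pseudo-inverse of `D* D` defined through the spectral decomposition. -/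
lemma exists_deriv_tsum_starProjection [CompleteSpace K] (hG : IsClosed (G : Set (E × K)))
    (hV : ∀ m, V m ≤ eigenspace G m) (Z : E) :
    ∃ W, (∑' m : ℕ, (1 / ((m + 1 : ℕ) : ℝ)) • (V (m + 1)).starProjection Z, W) ∈ G ∧
      ∀ q ∈ G, ⟪q.2, W⟫_ℝ = ⟪q.1, ∑' m : ℕ, (V (m + 1)).starProjection Z⟫_ℝ := by
  have hU : ∀ m, ∃ U, ((V (m + 1)).starProjection Z, U) ∈ eigenGraph G ((m + 1 : ℕ) : ℝ) :=
    fun m => mem_eigenspace.1 (hV _ ((V (m + 1)).starProjection_apply_mem Z))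
  choose U hU using hU
  have hsum : Summable fun m => (V (m + 1)).starProjection Z :=
    (summable_nat_add_iff (f := fun m => (V m).starProjection Z) 1).2
      (summable_starProjection hV Z)
  exact exists_deriv_tsum_of_eigenGraph hG hU (fun i j hij =>
    inner_starProjection_eq_zero hV Z (by omega)) hsum

end Hilbert

/-! ### Wiener chaoses as eigenspaces, and closability -/

lemma derivative_hermite_succ (n : ℕ) :
    Polynomial.derivative (Polynomial.hermite (n + 1)) = (n + 1 : ℤ) • Polynomial.hermite n := by
  induction n with
  | zero => simp [Polynomial.hermite_succ]
  | succ n ih =>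
    have h := Polynomial.hermite_succ n
    rw [Polynomial.hermite_succ (n + 1), Polynomial.derivative_sub, Polynomial.derivative_mul, ih,
      Polynomial.derivative_X, Polynomial.derivative_smul, one_mul, mul_smul_comm, add_sub_assoc,
      ← smul_sub, ← h]
    push_cast
    module

section WienerSpace

variable {Ω H : Type*} [NormedAddCommGroup H] [InnerProductSpace ℝ H] [MeasurableSpace Ω]
  {X : H → Ω → ℝ} {P : Measure Ω}

namespace IsIsonormal

/-- The random variable `Hₙ (X h)` in `L²`. -/
noncomputable def hermiteLp (hX : IsIsonormal X P) (n : ℕ) (h : H) : Lp ℝ 2 P :=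
  (hX.memLp_hermite h n).toLp _

lemma memLp_smul_const {G : Ω → ℝ} (hG : MemLp G 2 P) (h : H) :
    MemLp (fun ω => G ω • h) 2 P := by
  refine (hG.norm.mul_const ‖h‖).mono (hG.1.smul_const h) (Eventually.of_forall fun ω => ?_)
  rw [norm_smul, norm_mul, norm_norm, norm_norm]

/-- The random vector `Hₙ (X h) h` in `L²`. -/
noncomputable def hermiteSmulLp (hX : IsIsonormal X P) (n : ℕ) (h : H) : Lp H 2 P :=
  (memLp_smul_const (hX.memLp_hermite h n) h).toLp _

lemma inner_toLp_smul_const {f : Ω → H} (hf : MemLp f 2 P) {G : Ω → ℝ}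
    {h : H} (hG : MemLp (fun ω => G ω • h) 2 P) :
    ⟪hf.toLp f, hG.toLp _⟫_ℝ = ∫ ω, ⟪f ω, h⟫_ℝ * G ω ∂P := by
  rw [L2.inner_def]
  refine integral_congr_ae ?_
  filter_upwards [hf.coeFn_toLp, hG.coeFn_toLp] with ω a b
  rw [a, b, real_inner_smul_right, mul_comm]

lemma inner_toLp {f g : Ω → ℝ} (hf : MemLp f 2 P) (hg : MemLp g 2 P) :
    ⟪hf.toLp f, hg.toLp g⟫_ℝ = ∫ ω, f ω * g ω ∂P := by
  rw [L2.inner_def]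
  refine integral_congr_ae ?_
  filter_upwards [hf.coeFn_toLp, hg.coeFn_toLp] with ω a b
  rw [a, b, RCLike.inner_apply, conj_trivial, mul_comm]

lemma induction_derivGraph (hX : IsIsonormal X P) {p : Lp ℝ 2 P × Lp H 2 P → Prop}
    (hp : IsClosed {q | p q}) (h : ∀ q ∈ smoothGraph X P, p q) :
    ∀ q ∈ hX.derivGraph, p q :=
  closure_minimal h hp

/-- The adjoint as raising operator: D*(Hₙ(X h) h) = Hₙ₊₁(X h). Both sides are continuous in the
pair, so Gaussian integration by parts on cylinders suffices. -/
lemma inner_hermiteSmulLp (hX : IsIsonormal X P) {h : H} (hh : ‖h‖ = 1) (n : ℕ) :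
    ∀ q ∈ hX.derivGraph, ⟪q.2, hX.hermiteSmulLp n h⟫_ℝ = ⟪q.1, hX.hermiteLp (n + 1) h⟫_ℝ := by
  refine hX.induction_derivGraph (isClosed_eq (by fun_prop) (by fun_prop)) fun q hq => ?_
  obtain ⟨k, φ, f, C, -, hf, -, hC, hC', h1, h2, rfl⟩ := hX.exists_of_mem_smoothGraph hq
  rw [hermiteSmulLp, hermiteLp, inner_toLp, inner_toLp_smul_const]
  simp only [inner_cylDeriv]
  exact hX.integral_fderiv_mul_hermite φ hh (hf.of_le (by exact_mod_cast le_top)) hC hC' n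

/-- The lowering counterpart of `inner_hermiteSmulLp`. Hₙ₊₁ is unbounded, which is why cylindrical
functions without a support condition were admitted in `mem_closure_smoothGraph`. -/
lemma hermiteLp_succ_mem_derivGraph (hX : IsIsonormal X P) (n : ℕ) (h : H) :
    (hX.hermiteLp (n + 1) h, ((n + 1 : ℕ) : ℝ) • hX.hermiteSmulLp n h) ∈ hX.derivGraph := by
  let f : (Fin 1 → ℝ) → ℝ := fun x => Polynomial.aeval (x 0) (Polynomial.hermite (n + 1))
  have hu : Differentiable ℝ fun y : ℝ => Polynomial.aeval y (Polynomial.hermite (n + 1)) :=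
    fun y => (Polynomial.hasDerivAt_aeval _ y).differentiableAt
  have hf : ContDiff ℝ (⊤ : ℕ∞) f :=
    (Polynomial.contDiff_aeval _ _).comp (contDiff_apply ℝ ℝ (0 : Fin 1))
  have hD : ∀ x, cylDeriv (fun _ => h) f x
      = ((n + 1 : ℕ) : ℝ) • Polynomial.aeval (x 0) (Polynomial.hermite n) • h := by
    intro x
    have h0 : Differentiable ℝ fun x : Fin 1 → ℝ => x 0 := differentiable_apply 0
    rw [cylDeriv_comp (fun _ => h) hu h0 x, (Polynomial.hasDerivAt_aeval _ _).deriv,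
      derivative_hermite_succ]
    have h1 : cylDeriv (fun _ : Fin 1 => h) (fun x => x 0) x = h := by
      refine ext_inner_right ℝ fun k => ?_
      rw [inner_cylDeriv, (hasFDerivAt_apply (0 : Fin 1) x).fderiv]
      rfl
    rw [h1, map_zsmul, ← smul_assoc, zsmul_eq_mul]
    push_cast
    rfl
  have m1 := hX.memLp_hermite h (n + 1)
  have m2 := (memLp_smul_const (hX.memLp_hermite h n) h).const_smul ((n + 1 : ℕ) : ℝ)
  have m2' : MemLp (fun ω => cylDeriv (fun _ => h) f (fun _ => X h ω)) 2 P := by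
    simp only [hD]; exact m2
  convert! hX.mem_closure_smoothGraph le_rfl (fun _ => h) hf m1 m2' using 1
  refine Prod.ext rfl ?_
  simp only [hD]
  rfl

lemma hermiteLp_zero_mem_derivGraph (hX : IsIsonormal X P) (h : H) :
    (hX.hermiteLp 0 h, 0) ∈ hX.derivGraph := by
  have hprob := hX.isGaussian.isProbabilityMeasure
  have hD : ∀ x, cylDeriv (fun _ : Fin 1 => h) (fun _ => (1 : ℝ)) x = 0 := fun x => by
    simp [cylDeriv]
  have m1 : MemLp (fun _ : Ω => (1 : ℝ)) 2 P := memLp_const 1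
  have m2 : MemLp (fun ω =>
      cylDeriv (fun _ : Fin 1 => h) (fun _ => (1 : ℝ)) (fun _ => X h ω)) 2 P := by
    simp only [hD]; exact MemLp.zero
  convert! hX.mem_closure_smoothGraph le_rfl (fun _ => h) contDiff_const m1 m2 using 1
  refine Prod.ext ?_ ?_
  · simp [hermiteLp]
  · simp only [hD]; rfl

lemma hermiteLp_mem_eigenspace (hX : IsIsonormal X P) (n : ℕ) {h : H} (hh : n = 0 ∨ ‖h‖ = 1) :
    hX.hermiteLp n h ∈ eigenspace hX.derivGraph n := by
  rw [mem_eigenspace]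
  cases n with
  | zero => exact ⟨0, hX.hermiteLp_zero_mem_derivGraph h, fun q _ => by simp⟩
  | succ n =>
    refine ⟨_, hX.hermiteLp_succ_mem_derivGraph n h, fun q hq => ?_⟩
    rw [real_inner_smul_right, hX.inner_hermiteSmulLp (by simpa using hh) n q hq]

lemma chaos_le_eigenspace [CompleteSpace H] (hX : IsIsonormal X P) (m : ℕ) :
    chaos X P m ≤ eigenspace hX.derivGraph m := by
  refine Submodule.topologicalClosure_minimal _ (Submodule.span_le.2 ?_)
    (isClosed_eigenspace hX.isClosed_derivGraph m.cast_nonneg)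
  rintro F ⟨h, hh, hF⟩
  have : F = hX.hermiteLp m h := Lp.ext (hF.trans (MemLp.coeFn_toLp _).symm)
  rw [this]
  exact hX.hermiteLp_mem_eigenspace m hh

lemma hermiteLp_mem_chaos (hX : IsIsonormal X P) (n : ℕ) {h : H} (hh : n = 0 ∨ ‖h‖ = 1) :
    hX.hermiteLp n h ∈ chaos X P n :=
  Submodule.le_topologicalClosure _ (Submodule.subset_span ⟨h, hh, MemLp.coeFn_toLp _⟩)

/-- Integration by parts against a bounded cylindrical random variable. -/
lemma exists_inner_smul_eq (hX : IsIsonormal X P) {κ : Type*} [Fintype κ] [DecidableEq κ]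
    (ψ : κ → H) {g : (κ → ℝ) → ℝ} (hg : ContDiff ℝ 1 g) {C : ℝ} (hC : ∀ x, |g x| ≤ C)
    (hC' : ∀ x, ‖fderiv ℝ g x‖ ≤ C) {h : H} (hh : ‖h‖ = 1)
    (hm : MemLp (fun ω => g (fun i => X (ψ i) ω) • h) 2 P) :
    ∃ Y : Lp ℝ 2 P, ∀ q ∈ hX.derivGraph, ⟪q.2, hm.toLp _⟫_ℝ = ⟪q.1, Y⟫_ℝ := by
  have hprob := hX.isGaussian.isProbabilityMeasure
  have mX : MemLp (fun ω => g (fun i => X (ψ i) ω) * X h ω) 2 P := by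
    refine ((hX.memLp h).norm.const_mul C).mono
      ((hX.aestronglyMeasurable_comp ψ hg.continuous).mul (hX.memLp h).1)
      (Eventually.of_forall fun ω => ?_)
    rw [norm_mul, norm_mul, norm_norm]
    gcongr
    exact (hC _).trans (le_abs_self _)
  have mD : MemLp (fun ω => ⟪cylDeriv ψ g (fun i => X (ψ i) ω), h⟫_ℝ) 2 P :=
    (hX.memLp_cylDeriv_of_bound ψ hg hC').inner_const h
  -- The witness is the divergence D*(G h) = G X(h) - ⟨DG, h⟩ of the field G h, where G = g(X ψ).
  refine ⟨(mX.sub mD).toLp _, ?_⟩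
  refine hX.induction_derivGraph (isClosed_eq (by fun_prop) (by fun_prop)) fun q hq => ?_
  obtain ⟨k, φ, f, D, -, hf, -, hD, hD', h1, h2, rfl⟩ := hX.exists_of_mem_smoothGraph hq
  have hf1 : ContDiff ℝ 1 f := hf.of_le (by exact_mod_cast le_top)
  have hfd := hf1.differentiable one_ne_zero
  have hgd := hg.differentiable one_ne_zero
  rw [inner_toLp, inner_toLp_smul_const]
  have hC0 : 0 ≤ C := (norm_nonneg _).trans (hC' 0)
  have hD0 : 0 ≤ D := (norm_nonneg _).trans (hD' 0)
  let χ : Fin k ⊕ κ → H := Sum.elim φ ψ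
  let f' : (Fin k ⊕ κ → ℝ) → ℝ := fun x => f (fun i => x (Sum.inl i))
  let g' : (Fin k ⊕ κ → ℝ) → ℝ := fun x => g (fun i => x (Sum.inr i))
  let T : (Fin k ⊕ κ → ℝ) →L[ℝ] (Fin k → ℝ) :=
    ContinuousLinearMap.pi fun i => ContinuousLinearMap.proj (Sum.inl i)
  let S : (Fin k ⊕ κ → ℝ) →L[ℝ] (κ → ℝ) :=
    ContinuousLinearMap.pi fun i => ContinuousLinearMap.proj (Sum.inr i)
  have hf' : ContDiff ℝ 1 f' := hf1.comp T.contDiff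
  have hg' : ContDiff ℝ 1 g' := hg.comp S.contDiff
  have hf'd := hf'.differentiable one_ne_zero
  have hg'd := hg'.differentiable one_ne_zero
  have bf' : ∀ x, ‖fderiv ℝ f' x‖ ≤ D * ‖T‖ := fun x => by
    have : fderiv ℝ f' x = (fderiv ℝ f (T x)).comp T :=
      ((hfd (T x)).hasFDerivAt.comp x T.hasFDerivAt).fderiv
    rw [this]
    exact (ContinuousLinearMap.opNorm_comp_le _ _).trans (by gcongr; exact hD' _)
  have bg' : ∀ x, ‖fderiv ℝ g' x‖ ≤ C * ‖S‖ := fun x => by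
    have : fderiv ℝ g' x = (fderiv ℝ g (S x)).comp S :=
      ((hgd (S x)).hasFDerivAt.comp x S.hasFDerivAt).fderiv
    rw [this]
    exact (ContinuousLinearMap.opNorm_comp_le _ _).trans (by gcongr; exact hC' _)
  -- Index 0 of the Hermite formula, E⟨D(FG), h⟩ = E(FG X h), applied to a product of cylinders on
  -- the disjoint union of their index sets; the product rule then isolates E(G⟨DF, h⟩).
  have key := hX.integral_fderiv_mul_hermite χ hh (f := fun x => f' x * g' x)
    (C := max (D * C) (D * (C * ‖S‖) + C * (D * ‖T‖))) (hf'.mul hg')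
    (fun x => by
      rw [abs_mul]
      exact (mul_le_mul (hD _) (hC _) (abs_nonneg _) hD0).trans (le_max_left _ _))
    (fun x => by
      rw [fderiv_fun_mul (hf'd x) (hg'd x)]
      refine (norm_add_le _ _).trans (le_trans ?_ (le_max_right _ _))
      rw [norm_smul, norm_smul]
      exact add_le_add (mul_le_mul (hD _) (bg' x) (norm_nonneg _) hD0)
        (mul_le_mul (hC _) (bf' x) (norm_nonneg _) hC0)) 0
  simp only [← inner_cylDeriv, cylDeriv_mul χ hf'd hg'd] at key
  have r1 : ∀ x, cylDeriv χ f' x = cylDeriv φ f (fun i => x (Sum.inl i)) := fun x =>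
    cylDeriv_reindex χ Sum.inl hfd x
  have r2 : ∀ x, cylDeriv χ g' x = cylDeriv ψ g (fun i => x (Sum.inr i)) := fun x =>
    cylDeriv_reindex χ Sum.inr hgd x
  simp only [r1, r2, inner_add_left, real_inner_smul_left, f', g', χ, Sum.elim_inl, Sum.elim_inr,
    Polynomial.hermite_zero, Polynomial.hermite_one, zero_add, map_one, mul_one,
    Polynomial.aeval_X] at key
  have i1 : Integrable (fun ω => f (fun i => X (φ i) ω) *
      ⟪cylDeriv ψ g (fun i => X (ψ i) ω), h⟫_ℝ) P := h1.integrable_mul mD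
  have i2 : Integrable (fun ω => g (fun i => X (ψ i) ω) *
      ⟪cylDeriv φ f (fun i => X (φ i) ω), h⟫_ℝ) P :=
    (hX.memLp_comp_of_bound ψ hg.continuous hC).integrable_mul (h2.inner_const h)
  have i3 : Integrable (fun ω => f (fun i => X (φ i) ω) *
      (g (fun i => X (ψ i) ω) * X h ω)) P := h1.integrable_mul mX
  rw [integral_add i1 i2] at key
  simp only [Pi.sub_apply, mul_sub]
  rw [integral_sub i3 i1]
  simp only [← mul_assoc]
  rw [← key]
  simp only [mul_comm]
  ring

/-- For cylindrical F, DF is a finite sum of fields ∂ᵢf(X φ) φᵢ, each in the domain of D* by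
`exists_inner_smul_eq`. Pairing such a field with U amounts to pairing its divergence with 0. So U
is orthogonal to every DF, and being a limit of such derivatives it is orthogonal to itself. -/
lemma eq_zero_of_zero_mem_derivGraph (hX : IsIsonormal X P) {U : Lp H 2 P}
    (hU : (0, U) ∈ hX.derivGraph) : U = 0 := by
  suffices h : ∀ q ∈ hX.derivGraph, ⟪q.2, U⟫_ℝ = 0 by
    exact inner_self_eq_zero.1 (h _ hU)
  refine hX.induction_derivGraph (isClosed_eq (by fun_prop) (by fun_prop)) fun q hq => ?_
  obtain ⟨n, φ, f, C, -, hf, hc, -, -, h1, h2, rfl⟩ := hX.exists_of_mem_smoothGraph hq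
  let G : Fin n → (Fin n → ℝ) → ℝ := fun i x => fderiv ℝ f x (Pi.single i 1)
  have hG : ∀ i, ContDiff ℝ 1 (G i) := fun i =>
    ((contDiff_infty.1 hf 2).fderiv_right (m := 1) (by norm_num)).clm_apply contDiff_const
  have hGc : ∀ i, HasCompactSupport (G i) := fun i => hc.fderiv_apply ℝ _
  have hm : ∀ i, MemLp (fun ω => G i (fun i => X (φ i) ω) • φ i) 2 P := fun i => by
    obtain ⟨D, hD, -⟩ := exists_bound_of_hasCompactSupport (hG i) (hGc i)
    exact memLp_smul_const (hX.memLp_comp_of_bound φ (hG i).continuous hD) _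
  have h0 : ∀ i, ⟪(hm i).toLp _, U⟫_ℝ = 0 := by
    intro i
    obtain ⟨D, hD, hD'⟩ := exists_bound_of_hasCompactSupport (hG i) (hGc i)
    rcases eq_or_ne (φ i) 0 with hz | hz
    · have : (hm i).toLp _ = 0 := by
        rw [Lp.eq_zero_iff_ae_eq_zero]
        filter_upwards [(hm i).coeFn_toLp] with ω hω
        rw [hω, hz, smul_zero]
        rfl
      rw [this, inner_zero_left]
    · have hm' := memLp_smul_const (hX.memLp_comp_of_bound φ (hG i).continuous hD)
        (‖φ i‖⁻¹ • φ i)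
      obtain ⟨Y, hY⟩ := hX.exists_inner_smul_eq φ (hG i) hD hD' (h := ‖φ i‖⁻¹ • φ i)
        (by rw [norm_smul, norm_inv, norm_norm, inv_mul_cancel₀ (norm_ne_zero_iff.2 hz)]) hm'
      have h1 := hY _ hU
      have h2 : (hm i).toLp _ = ‖φ i‖ • hm'.toLp _ := by
        rw [← MemLp.toLp_const_smul]
        refine MemLp.toLp_congr _ _ (Eventually.of_forall fun ω => ?_)
        simp only [Pi.smul_apply]
        rw [smul_comm ‖φ i‖, smul_inv_smul₀ (norm_ne_zero_iff.2 hz)]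
      rw [h2, real_inner_smul_left, real_inner_comm, h1, inner_zero_left, mul_zero]
  have hsum : h2.toLp _ = ∑ i, (hm i).toLp _ := by
    refine Lp.ext ?_
    have hall : ∀ᵐ ω ∂P, ∀ i, (hm i).toLp _ ω = G i (fun i => X (φ i) ω) • φ i :=
      ae_all_iff.2 fun i => (hm i).coeFn_toLp
    filter_upwards [h2.coeFn_toLp, hall, Lp.coeFn_finsetSum Finset.univ fun i => (hm i).toLp _]
      with ω a b c
    rw [a, c, Finset.sum_apply]
    exact Finset.sum_congr rfl fun i _ => (b i).symm
  rw [hsum, sum_inner]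
  exact Finset.sum_eq_zero fun i _ => h0 i

/-- Closability of the Malliavin derivative. -/
lemma deriv_eq (hX : IsIsonormal X P) {Z : Lp ℝ 2 P} {U : Lp H 2 P}
    (hU : (Z, U) ∈ hX.derivGraph) : deriv X P Z = U := by
  have hex : ∃ U, IsDeriv X P Z U := ⟨U, hU⟩
  rw [deriv, dif_pos hex]
  have h : (Z, hex.choose) ∈ hX.derivGraph := hex.choose_spec
  have := hX.derivGraph.sub_mem h hU
  rw [Prod.mk_sub_mk, sub_self] at this
  exact sub_eq_zero.1 (hX.eq_zero_of_zero_mem_derivGraph this)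

/-! ### Totality of the chaoses -/

/-- Linearity of X is not part of the definition. It follows from the covariance: the difference of
the two sides is orthogonal in L² to every X g, hence to itself. -/
lemma ae_eq_sum_mul (hX : IsIsonormal X P) {ι : Type*} [Fintype ι] (φ : ι → H) (c : ι → ℝ) :
    X (∑ i, c i • φ i) =ᵐ[P] fun ω => ∑ i, c i * X (φ i) ω := by
  let ξ : H → Lp ℝ 2 P := fun h => (hX.memLp h).toLp _
  have hξ : ∀ h k, ⟪ξ h, ξ k⟫_ℝ = ⟪h, k⟫_ℝ := fun h k => by
    rw [inner_toLp, hX.covariance]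
  set v : Lp ℝ 2 P := ξ (∑ i, c i • φ i) - ∑ i, c i • ξ (φ i) with hv
  have h1 : ∀ g, ⟪v, ξ g⟫_ℝ = 0 := fun g => by
    simp only [hv, inner_sub_left, sum_inner, real_inner_smul_left, hξ, sub_self]
  have h2 : v = 0 := by
    rw [← inner_self_eq_zero (𝕜 := ℝ)]
    nth_rewrite 2 [hv]
    rw [inner_sub_right, inner_sum, h1]
    simp [real_inner_smul_right, h1]
  have h3 : ξ (∑ i, c i • φ i) = ∑ i, c i • ξ (φ i) := sub_eq_zero.1 h2
  have hall : ∀ᵐ ω ∂P, ∀ i, (c i • ξ (φ i) : Lp ℝ 2 P) ω = c i * X (φ i) ω :=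
    ae_all_iff.2 fun i => by
      filter_upwards [Lp.coeFn_smul (c i) (ξ (φ i)), (hX.memLp (φ i)).coeFn_toLp] with ω a b
      rw [a, Pi.smul_apply, b, smul_eq_mul]
  filter_upwards [(hX.memLp (∑ i, c i • φ i)).coeFn_toLp, hall,
    Lp.coeFn_finsetSum Finset.univ fun i => c i • ξ (φ i)] with ω a b d
  rw [← a]
  change ξ (∑ i, c i • φ i) ω = _
  rw [h3, d, Finset.sum_apply]
  exact Finset.sum_congr rfl fun i _ => b i

lemma ae_eq_mul (hX : IsIsonormal X P) (c : ℝ) (h : H) : X (c • h) =ᵐ[P] fun ω => c * X h ω := by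
  simpa using hX.ae_eq_sum_mul (fun _ : Unit => h) (fun _ => c)

lemma memLp_pow_mul_hermite (hX : IsIsonormal X P) (h : H) (k n : ℕ) :
    MemLp (fun ω => X h ω ^ k * Polynomial.aeval (X h ω) (Polynomial.hermite n)) 2 P := by
  have := memLp_aeval_of_hasGaussianLaw (hX.isGaussian.hasGaussianLaw_eval h)
    (Polynomial.X ^ k * Polynomial.hermite n)
  simpa using this

/-- A random variable that is orthogonal to all chaoses is orthogonal to all monomials. -/
lemma integral_mul_pow_eq_zero (hX : IsIsonormal X P) {Y : Lp ℝ 2 P}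
    (hY : ∀ m, ∀ F ∈ chaos X P m, ⟪F, Y⟫_ℝ = 0) (h : H) (k : ℕ) :
    ∫ ω, Y ω * X h ω ^ k ∂P = 0 := by
  have hherm : ∀ {h : H} (n : ℕ), n = 0 ∨ ‖h‖ = 1 →
      ∫ ω, Y ω * Polynomial.aeval (X h ω) (Polynomial.hermite n) ∂P = 0 := by
    intro h n hh
    have h1 := hY n _ (hX.hermiteLp_mem_chaos n hh)
    rw [L2.inner_def] at h1
    rw [← h1]
    refine integral_congr_ae ?_
    filter_upwards [(hX.memLp_hermite h n).coeFn_toLp] with ω a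
    rw [hermiteLp, a, RCLike.inner_apply, conj_trivial]
  have hunit : ∀ {h : H}, ‖h‖ = 1 → ∀ k n : ℕ,
      ∫ ω, Y ω * (X h ω ^ k * Polynomial.aeval (X h ω) (Polynomial.hermite n)) ∂P = 0 := by
    intro h hh k
    induction k with
    | zero => intro n; simpa using hherm n (Or.inr hh)
    | succ k ih =>
      have hint : ∀ j m, Integrable (fun ω => Y ω * (X h ω ^ j *
          Polynomial.aeval (X h ω) (Polynomial.hermite m))) P := fun j m =>
        (Lp.memLp Y).integrable_mul (hX.memLp_pow_mul_hermite h j m)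
      intro n
      cases n with
      | zero =>
        have := ih 1
        simpa [pow_succ] using this
      | succ n =>
        -- The three-term recurrence trades a power of X h for neighbouring Hermite indices, so the
        -- induction on the power must hold for all indices at once.
        have e : ∀ x : ℝ, x * Polynomial.aeval x (Polynomial.hermite (n + 1))
            = Polynomial.aeval x (Polynomial.hermite (n + 2))
              + (n + 1) * Polynomial.aeval x (Polynomial.hermite n) := by
          intro x
          rw [Polynomial.hermite_succ (n + 1), derivative_hermite_succ]
          simp
        have e2 : ∀ ω, Y ω * (X h ω ^ (k + 1) *
            Polynomial.aeval (X h ω) (Polynomial.hermite (n + 1)))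
            = Y ω * (X h ω ^ k * Polynomial.aeval (X h ω) (Polynomial.hermite (n + 2)))
              + (n + 1) * (Y ω * (X h ω ^ k *
                Polynomial.aeval (X h ω) (Polynomial.hermite n))) := by
          intro ω
          rw [pow_succ, mul_assoc (X h ω ^ k), e]
          ring
        simp only [e2]
        rw [integral_add (hint _ _) ((hint _ _).const_mul _), integral_const_mul, ih, ih]
        simp
  rcases eq_or_ne h 0 with rfl | h0
  -- The zero vector cannot be normalised; here X 0 = 0 almost surely, and only E Y = 0 is needed,
  -- which comes from the chaos of order zero.
  · have hz : X (0 : H) =ᵐ[P] fun _ => 0 := by simpa using hX.ae_eq_mul 0 0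
    have h1 := hherm (h := (0 : H)) 0 (Or.inl rfl)
    simp only [Polynomial.hermite_zero, map_one, mul_one] at h1
    have h2 : ∫ ω, Y ω * X 0 ω ^ k ∂P = ∫ ω, Y ω * 0 ^ k ∂P := by
      refine integral_congr_ae ?_
      filter_upwards [hz] with ω hω
      rw [hω]
    rw [h2, integral_mul_const, h1, zero_mul]
  · have hn := norm_ne_zero_iff.2 h0
    have h1 := hunit (h := ‖h‖⁻¹ • h)
      (by rw [norm_smul, norm_inv, norm_norm, inv_mul_cancel₀ hn]) k 0
    simp only [Polynomial.hermite_zero, map_one, mul_one] at h1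
    have h2 : ∫ ω, Y ω * X h ω ^ k ∂P
        = ∫ ω, ‖h‖ ^ k * (Y ω * X (‖h‖⁻¹ • h) ω ^ k) ∂P := by
      refine integral_congr_ae ?_
      filter_upwards [hX.ae_eq_mul ‖h‖⁻¹ h] with ω hω
      rw [hω, mul_left_comm, ← mul_pow, mul_inv_cancel_left₀ hn]
    rw [h2, integral_const_mul, h1, mul_zero]

lemma memLp_exp_abs (hX : IsIsonormal X P) (h : H) :
    MemLp (fun ω => Real.exp |X h ω|) 2 P := by
  have hm := hX.isGaussian.aemeasurable h
  rw [memLp_two_iff_integrable_sq (by fun_prop)]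
  have hexp : ∀ t : ℝ, Integrable (fun ω => Real.exp (t * X h ω)) P := by
    intro t
    have h1 := integrable_exp_mul_gaussianReal (μ := P[X h]) (v := Var[X h; P].toNNReal) t
    rw [← (hX.isGaussian.hasGaussianLaw_eval h).map_eq_gaussianReal] at h1
    exact h1.comp_aemeasurable hm
  refine ((hexp 2).add (hexp (-2))).mono' (by fun_prop) (Eventually.of_forall fun ω => ?_)
  rw [Real.norm_of_nonneg (by positivity), ← Real.exp_nat_mul]
  simp only [Pi.add_apply]
  rcases abs_choice (X h ω) with h | h <;> rw [h] <;> push_cast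
  · exact le_add_of_nonneg_right (Real.exp_pos _).le
  · rw [mul_neg, ← neg_mul]; exact le_add_of_nonneg_left (Real.exp_pos _).le

/-- The exponential series is integrated term by term, with dominating function |Y| e^{|X h|}; each
term is a moment that vanishes. -/
lemma integral_mul_cexp_eq_zero (hX : IsIsonormal X P) {Y : Lp ℝ 2 P}
    (hY : ∀ m, ∀ F ∈ chaos X P m, ⟪F, Y⟫_ℝ = 0) (h : H) :
    ∫ ω, (Y ω : ℂ) * Complex.exp (X h ω * Complex.I) ∂P = 0 := by
  have hm := hX.isGaussian.aemeasurable h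
  have hYm : AEMeasurable (fun ω => Y ω) P := (Lp.aestronglyMeasurable Y).aemeasurable
  have hsum : ∀ x : ℝ, HasSum (fun n : ℕ => |x| ^ n / n.factorial) (Real.exp |x|) := fun x => by
    rw [Real.exp_eq_exp_ℝ]; exact NormedSpace.expSeries_div_hasSum_exp _
  have key := hasSum_integral_of_dominated_convergence (μ := P)
    (F := fun (n : ℕ) ω => (Y ω : ℂ) * ((X h ω * Complex.I) ^ n / n.factorial))
    (f := fun ω => (Y ω : ℂ) * Complex.exp (X h ω * Complex.I))
    (fun n ω => |Y ω| * (|X h ω| ^ n / n.factorial)) (fun n => by fun_prop)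
    (fun n => Eventually.of_forall fun ω => by simp)
    (Eventually.of_forall fun ω => (hsum _).summable.mul_left _)
    (by
      simp only [tsum_mul_left, (hsum _).tsum_eq]
      exact (Lp.memLp Y).abs.integrable_mul (hX.memLp_exp_abs h))
    (Eventually.of_forall fun ω => by
      refine HasSum.mul_left _ ?_
      rw [Complex.exp_eq_exp_ℂ]
      exact NormedSpace.expSeries_div_hasSum_exp _)
  have hzero : ∀ n : ℕ, ∫ ω, (Y ω : ℂ) * ((X h ω * Complex.I) ^ n / n.factorial) ∂P = 0 := by
    intro n
    have e : ∀ ω, (Y ω : ℂ) * ((X h ω * Complex.I) ^ n / n.factorial)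
        = (Complex.I ^ n / n.factorial) * ((Y ω * X h ω ^ n : ℝ) : ℂ) := fun ω => by
      push_cast; rw [mul_pow]; ring
    simp only [e]
    rw [integral_const_mul, integral_complex_ofReal, hX.integral_mul_pow_eq_zero hY]
    simp
  simp only [hzero] at key
  exact key.unique hasSum_zero

/-- Splitting Y into positive and negative parts replaces a signed measure by two positive ones, to
which uniqueness of characteristic functions applies. -/
lemma integral_comp_eq_sub {E G : Type*} [MeasurableSpace E] [TopologicalSpace E]
    [OpensMeasurableSpace E] [SecondCountableTopology E]
    [NormedAddCommGroup G] [NormedSpace ℝ G] [SecondCountableTopologyEither E G]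
    {Y : Ω → ℝ} (hY : Integrable Y P) {T : Ω → E} (hT : AEMeasurable T P)
    {f : E → G} (hf : Continuous f) {C : ℝ} (hC : ∀ x, ‖f x‖ ≤ C) :
    ∫ ω, Y ω • f (T ω) ∂P = ∫ x, f x ∂(P.withDensity fun ω => ENNReal.ofReal (Y ω)).map T
      - ∫ x, f x ∂(P.withDensity fun ω => ENNReal.ofReal (-Y ω)).map T := by
  have hfT : AEStronglyMeasurable (fun ω => f (T ω)) P :=
    hf.stronglyMeasurable.aestronglyMeasurable.comp_aemeasurable hT
  have key : ∀ Y : Ω → ℝ, Integrable Y P →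
      ∫ x, f x ∂(P.withDensity fun ω => ENNReal.ofReal (Y ω)).map T
        = ∫ ω, max (Y ω) 0 • f (T ω) ∂P := by
    intro Y hY
    have hT' : AEMeasurable T (P.withDensity fun ω => ENNReal.ofReal (Y ω)) :=
      hT.mono_ac (withDensity_absolutelyContinuous _ _)
    rw [integral_map hT' hf.stronglyMeasurable.aestronglyMeasurable,
      integral_withDensity_eq_integral_toReal_smul₀ hY.aemeasurable.ennreal_ofReal
        (Eventually.of_forall fun _ => ENNReal.ofReal_lt_top)]
    simp only [ENNReal.toReal_ofReal']
  have hint : ∀ Y : Ω → ℝ, Integrable Y P → Integrable (fun ω => max (Y ω) 0 • f (T ω)) P :=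
    fun Y hY => hY.pos_part.smul_bdd C hfT (Eventually.of_forall fun _ => hC _)
  rw [key Y hY, key (fun ω => -Y ω) hY.neg,
    ← integral_sub (hint Y hY) (hint (fun ω => -Y ω) hY.neg)]
  congr 1
  ext ω
  rw [← sub_smul]
  congr 1
  rcases le_total (Y ω) 0 with h | h
  · rw [max_eq_right h, max_eq_left (by linarith)]; ring
  · rw [max_eq_left h, max_eq_right (by linarith)]; ring

/-- The images of Y⁺P and Y⁻P under (X φᵢ) have equal characteristic functions, because a linear
form of this vector is again some X h almost surely. So the images agree, and Y is orthogonal to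
every function f(X φ). -/
lemma inner_eq_zero_of_forall_chaos (hX : IsIsonormal X P) {Y : Lp ℝ 2 P}
    (hY : ∀ m, ∀ F ∈ chaos X P m, ⟪F, Y⟫_ℝ = 0) : ∀ q ∈ hX.derivGraph, ⟪q.1, Y⟫_ℝ = 0 := by
  have hprob := hX.isGaussian.isProbabilityMeasure
  refine hX.induction_derivGraph (isClosed_eq (by fun_prop) (by fun_prop)) fun q hq => ?_
  obtain ⟨n, φ, f, C, -, hf, -, hC, -, h1, h2, rfl⟩ := hX.exists_of_mem_smoothGraph hq
  have hYi : Integrable (fun ω => Y ω) P := (Lp.memLp Y).integrable (by norm_num)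
  have hT := hX.aemeasurable_pi φ
  have hfin : ∀ Y : Ω → ℝ, Integrable Y P →
      IsFiniteMeasure ((P.withDensity fun ω => ENNReal.ofReal (Y ω)).map
        (fun ω i => X (φ i) ω)) := fun Y hY => by
    have := isFiniteMeasure_withDensity_ofReal hY.2
    infer_instance
  have i1 := hfin _ hYi
  have i2 := hfin _ hYi.neg
  have hL : ⟪h1.toLp _, Y⟫_ℝ = ∫ ω, Y ω • f (fun i => X (φ i) ω) ∂P := by
    rw [L2.inner_def]
    refine integral_congr_ae ?_
    filter_upwards [h1.coeFn_toLp] with ω a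
    rw [a, RCLike.inner_apply, conj_trivial, smul_eq_mul]
  rw [hL, integral_comp_eq_sub hYi hT hf.continuous hC, sub_eq_zero]
  congr 1
  refine Measure.ext_of_charFunDual (funext fun L => ?_)
  rw [charFunDual_apply, charFunDual_apply, ← sub_eq_zero,
    ← integral_comp_eq_sub hYi hT (f := fun v : Fin n → ℝ => Complex.exp (L v * Complex.I))
      (by fun_prop) (C := 1) (fun v => (Complex.norm_exp_ofReal_mul_I _).le)]
  rw [← hX.integral_mul_cexp_eq_zero hY (∑ i, L (Pi.single i 1) • φ i)]
  refine integral_congr_ae ?_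
  filter_upwards [hX.ae_eq_sum_mul φ fun i => L (Pi.single i 1)] with ω hω
  have : L (fun i => X (φ i) ω) = ∑ i, L (Pi.single i 1) * X (φ i) ω := by
    conv_lhs => rw [← Finset.univ_sum_single (fun i => X (φ i) ω), map_sum]
    refine Finset.sum_congr rfl fun i _ => ?_
    have : (Pi.single i (X (φ i) ω) : Fin n → ℝ) = X (φ i) ω • Pi.single i 1 := by
      rw [← Pi.single_smul]; simp
    rw [this, map_smul, smul_eq_mul, mul_comm]
  rw [hω, ← this, Complex.real_smul]

/-- The Wiener chaos decomposition of random variables in the domain of the derivative. -/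
lemma tsum_chaosProj [CompleteSpace H] (hX : IsIsonormal X P) {Z : Lp ℝ 2 P} {U : Lp H 2 P}
    (hZ : (Z, U) ∈ hX.derivGraph) : ∑' m, chaosProj X P m Z = Z := by
  have hV := hX.chaos_le_eigenspace
  set Y := Z - ∑' m, (chaos X P m).starProjection Z with hYdef
  have hY : ∀ m, ∀ F ∈ chaos X P m, ⟪F, Y⟫_ℝ = 0 := fun m F hF =>
    inner_sub_tsum_starProjection hV Z hF
  have h1 : ⟪Z, Y⟫_ℝ = 0 := hX.inner_eq_zero_of_forall_chaos hY _ hZ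
  have h2 : ⟪Y, ∑' m, (chaos X P m).starProjection Z⟫_ℝ = 0 := by
    have h := (summable_starProjection hV Z).hasSum.mapL (innerSL ℝ Y)
    simp only [innerSL_apply_apply] at h
    refine h.unique ?_
    convert hasSum_zero using 2 with m
    rw [real_inner_comm]
    exact hY m _ ((chaos X P m).starProjection_apply_mem Z)
  have h3 : Y = 0 := by
    rw [← inner_self_eq_zero (𝕜 := ℝ)]
    nth_rewrite 1 [hYdef]
    rw [inner_sub_left, h1, real_inner_comm, h2, sub_zero]
  exact (sub_eq_zero.1 h3).symm

/-- Integration by parts with the pseudo-inverse of the Ornstein-Uhlenbeck generator. -/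
lemma inner_deriv_Linv [CompleteSpace H] (hX : IsIsonormal X P) {Z : Lp ℝ 2 P} {U : Lp H 2 P}
    (hZ : (Z, U) ∈ hX.derivGraph) (hZ0 : ∫ ω, Z ω ∂P = 0) :
    ∀ q ∈ hX.derivGraph, ⟪q.2, -deriv X P (Linv X P Z)⟫_ℝ = ⟪q.1, Z⟫_ℝ := by
  have hV := hX.chaos_le_eigenspace
  obtain ⟨W, hW, hWq⟩ := exists_deriv_tsum_starProjection hX.isClosed_derivGraph hV Z
  have hlin : Linv X P Z
      = -∑' m : ℕ, (1 / ((m + 1 : ℕ) : ℝ)) • (chaos X P (m + 1)).starProjection Z := by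
    rw [Linv, ← tsum_neg]
    simp only [neg_smul]
    rfl
  have hD : deriv X P (Linv X P Z) = -W := by
    rw [hlin]; exact hX.deriv_eq (hX.derivGraph.neg_mem hW)
  -- As H₀ = 1, the chaos of order zero consists of constants, and E Z = 0 makes Z orthogonal to it.
  have h0 : (chaos X P 0).starProjection Z = 0 := by
    rw [Submodule.starProjection_apply_eq_zero_iff]
    have : chaos X P 0 ≤ (ℝ ∙ Z)ᗮ := by
      refine Submodule.topologicalClosure_minimal _ (Submodule.span_le.2 ?_)
        (Submodule.isClosed_orthogonal _)
      rintro F ⟨h, -, hF⟩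
      rw [SetLike.mem_coe, Submodule.mem_orthogonal_singleton_iff_inner_left, L2.inner_def, ← hZ0]
      refine integral_congr_ae ?_
      filter_upwards [hF] with ω hω
      rw [hω, RCLike.inner_apply]
      simp
    rw [Submodule.mem_orthogonal]
    exact fun F hF => (Submodule.mem_orthogonal_singleton_iff_inner_left.1 (this hF))
  intro q hq
  rw [hD, neg_neg, hWq q hq]
  have h1 : ∑' m, (chaos X P m).starProjection Z = Z := hX.tsum_chaosProj hZ
  rw [Summable.tsum_eq_zero_add (summable_starProjection hV Z), h0, zero_add] at h1
  rw [h1]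

end IsIsonormal

/-! ### Chain rule and the formula for E(Z u(Z)) -/

lemma abs_comp_sub_le {u : ℝ → ℝ} (hu : Differentiable ℝ u) {C : ℝ}
    (hC : ∀ x, |_root_.deriv u x| ≤ C) (x y : ℝ) : |u x - u y| ≤ C * |x - y| :=
  Convex.norm_image_sub_le_of_norm_deriv_le (fun z _ => hu z) (fun z _ => hC z) convex_univ
    (Set.mem_univ y) (Set.mem_univ x)

lemma memLp_comp_of_deriv_le {u : ℝ → ℝ} (hu : Differentiable ℝ u) (hu0 : u 0 = 0) {C : ℝ}
    (hC : ∀ x, |_root_.deriv u x| ≤ C) (Z : Lp ℝ 2 P) : MemLp (fun ω => u (Z ω)) 2 P := by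
  refine ((Lp.memLp Z).norm.const_mul C).mono
    (hu.continuous.comp_aestronglyMeasurable (Lp.aestronglyMeasurable Z))
    (Eventually.of_forall fun ω => ?_)
  have := abs_comp_sub_le hu hC (Z ω) 0
  rw [hu0, sub_zero, sub_zero] at this
  exact this.trans (le_abs_self _)

lemma memLp_bdd_smul {a : Ω → ℝ} (ha : AEStronglyMeasurable a P) {C : ℝ} (hC : ∀ ω, |a ω| ≤ C)
    {f : Ω → H} (hf : MemLp f 2 P) : MemLp (fun ω => a ω • f ω) 2 P := by
  refine (hf.norm.const_mul C).mono (ha.smul hf.1) (Eventually.of_forall fun ω => ?_)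
  rw [norm_smul, norm_mul, norm_norm]
  gcongr
  exact (hC ω).trans (le_abs_self _)

lemma memLp_deriv_comp_smul {u : ℝ → ℝ} (hu : Continuous (_root_.deriv u)) {C : ℝ}
    (hC : ∀ x, |_root_.deriv u x| ≤ C) (Z : Lp ℝ 2 P) (U : Lp H 2 P) :
    MemLp (fun ω => _root_.deriv u (Z ω) • U ω) 2 P :=
  memLp_bdd_smul (hu.comp_aestronglyMeasurable (Lp.aestronglyMeasurable Z)) (fun _ => hC _)
    (Lp.memLp U)

namespace IsIsonormal

/-- The condition u(0) = 0 is what keeps the support of u ∘ f compact. -/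
lemma comp_mem_smoothGraph {u : ℝ → ℝ} (hu : ContDiff ℝ (⊤ : ℕ∞) u)
    (hu0 : u 0 = 0) {q : Lp ℝ 2 P × Lp H 2 P} (hq : q ∈ smoothGraph X P)
    (h1 : MemLp (fun ω => u (q.1 ω)) 2 P)
    (h2 : MemLp (fun ω => _root_.deriv u (q.1 ω) • q.2 ω) 2 P) :
    (h1.toLp _, h2.toLp _) ∈ smoothGraph X P := by
  obtain ⟨n, φ, f, hn, hf, hc, e1, e2⟩ := hq
  refine ⟨n, φ, fun x => u (f x), hn, hu.comp hf, hc.comp_left hu0, ?_, ?_⟩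
  · filter_upwards [h1.coeFn_toLp, e1] with ω a b
    rw [a, b]
  · filter_upwards [h2.coeFn_toLp, e1, e2] with ω a b c
    rw [a, b, c]
    exact (cylDeriv_comp φ (hu.differentiable (by simp)) (hf.differentiable (by simp)) _).symm

/-- The chain rule for the Malliavin derivative. -/
lemma comp_mem_derivGraph (hX : IsIsonormal X P) {u : ℝ → ℝ} (hu : ContDiff ℝ (⊤ : ℕ∞) u)
    (hu0 : u 0 = 0) {C : ℝ} (hC : ∀ x, |_root_.deriv u x| ≤ C) {Z : Lp ℝ 2 P} {U : Lp H 2 P}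
    (hZ : (Z, U) ∈ hX.derivGraph) (h1 : MemLp (fun ω => u (Z ω)) 2 P)
    (h2 : MemLp (fun ω => _root_.deriv u (Z ω) • U ω) 2 P) :
    (h1.toLp _, h2.toLp _) ∈ hX.derivGraph := by
  have hud : Differentiable ℝ u := hu.differentiable (by simp)
  have hu' : Continuous (_root_.deriv u) := hu.continuous_deriv (by simp)
  have hC0 : 0 ≤ C := (abs_nonneg _).trans (hC 0)
  obtain ⟨q, hq, hlim⟩ := mem_closure_iff_seq_limit.1 hZ
  obtain ⟨hl1, hl2⟩ := Prod.tendsto_iff _ _ |>.1 hlim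
  obtain ⟨ns, hns, hae⟩ := (tendstoInMeasure_of_tendsto_Lp hl1).exists_seq_tendsto_ae
  have m1 : ∀ n, MemLp (fun ω => u ((q n).1 ω)) 2 P := fun n => memLp_comp_of_deriv_le hud hu0 hC _
  have m2 : ∀ n, MemLp (fun ω => _root_.deriv u ((q n).1 ω) • (q n).2 ω) 2 P := fun n =>
    memLp_deriv_comp_smul hu' hC _ _
  -- Intermediate term between u'(Zₙ) DZₙ and u'(Z) U: the first gap is at most C‖DZₙ - U‖, the
  -- second closes by dominated convergence along the almost surely convergent subsequence.
  have m3 : ∀ n, MemLp (fun ω => _root_.deriv u ((q n).1 ω) • U ω) 2 P := fun n =>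
    memLp_deriv_comp_smul hu' hC _ _
  refine mem_closure_of_tendsto (f := fun k => ((m1 (ns k)).toLp _, (m2 (ns k)).toLp _))
    (b := atTop) (Tendsto.prodMk_nhds ?_ ?_)
    (Eventually.of_forall fun k => comp_mem_smoothGraph hu hu0 (hq _) _ _)
  · have hlim1 := ((tendsto_iff_norm_sub_tendsto_zero.1 hl1).comp hns.tendsto_atTop).const_mul C
    rw [mul_zero] at hlim1
    refine tendsto_iff_norm_sub_tendsto_zero.2 (squeeze_zero (fun _ => norm_nonneg _)
      (fun k => ?_) hlim1)
    rw [← MemLp.toLp_sub]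
    refine Lp.norm_le_mul_norm_of_ae_le_mul ?_
    filter_upwards [((m1 (ns k)).sub h1).coeFn_toLp, Lp.coeFn_sub (q (ns k)).1 Z] with ω a b
    rw [a, b]
    exact abs_comp_sub_le hud hC _ _
  · have hB : Tendsto (fun k => (m3 (ns k)).toLp _) atTop (𝓝 (h2.toLp _)) := by
      refine tendsto_toLp_of_dominated (fun k => m3 (ns k)) h2 ((Lp.memLp U).norm.const_mul C)
        (fun k => Eventually.of_forall fun ω => ?_) ?_
      · rw [norm_smul]
        gcongr
        exact hC _
      · filter_upwards [hae] with ω hω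
        exact ((hu'.tendsto _).comp hω).smul_const _
    have hA : Tendsto (fun k => (m2 (ns k)).toLp _ - (m3 (ns k)).toLp _) atTop (𝓝 0) := by
      have hlim2 := ((tendsto_iff_norm_sub_tendsto_zero.1 hl2).comp hns.tendsto_atTop).const_mul C
      rw [mul_zero] at hlim2
      refine squeeze_zero_norm (fun k => ?_) hlim2
      rw [← MemLp.toLp_sub]
      refine Lp.norm_le_mul_norm_of_ae_le_mul ?_
      filter_upwards [((m2 (ns k)).sub (m3 (ns k))).coeFn_toLp, Lp.coeFn_sub (q (ns k)).2 U]
        with ω a b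
      rw [a, b, Pi.sub_apply, Pi.sub_apply, ← smul_sub, norm_smul]
      gcongr
      exact hC _
    simpa using hA.add hB

/-- The integration by parts formula that characterizes `g(Z)`. -/
lemma integral_mul_comp_eq [CompleteSpace H] (hX : IsIsonormal X P) {Z : Lp ℝ 2 P}
    (hZ : Z ∈ D12 X P) (hZ0 : ∫ ω, Z ω ∂P = 0) {u : ℝ → ℝ} (hu : ContDiff ℝ (⊤ : ℕ∞) u)
    (hu0 : u 0 = 0) {C : ℝ} (hC : ∀ x, |_root_.deriv u x| ≤ C) :
    ∫ ω, Z ω * u (Z ω) ∂P = ∫ ω, _root_.deriv u (Z ω) * gZ X P Z ω ∂P := by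
  have hprob := hX.isGaussian.isProbabilityMeasure
  obtain ⟨U, hU⟩ := hZ
  have hU : (Z, U) ∈ hX.derivGraph := hU
  have hu' : Continuous (_root_.deriv u) := hu.continuous_deriv (by simp)
  have h1 := memLp_comp_of_deriv_le (hu.differentiable (by simp)) hu0 hC Z
  have h2 := memLp_deriv_comp_smul hu' hC Z U
  have key := hX.inner_deriv_Linv hU hZ0 _ (hX.comp_mem_derivGraph hu hu0 hC hU h1 h2)
  simp only [L2.inner_def] at key
  set F : Ω → ℝ := fun ω => ⟪deriv X P Z ω, -(deriv X P (Linv X P Z) ω)⟫_ℝ with hF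
  have hFi : Integrable F P := by
    simp only [hF, inner_neg_right]
    exact (L2.integrable_inner (𝕜 := ℝ) _ _).neg
  have hZm : Measurable (fun ω => Z ω) := (Lp.stronglyMeasurable Z).measurable
  have hm : MeasurableSpace.comap (fun ω => Z ω) (borel ℝ) ≤ ‹MeasurableSpace Ω› := hZm.comap_le
  have hsm : StronglyMeasurable[MeasurableSpace.comap (fun ω => Z ω) (borel ℝ)]
      (fun ω => _root_.deriv u (Z ω)) :=
    (hu'.measurable.comp (comap_measurable (fun ω => Z ω))).stronglyMeasurable
  have hprod : Integrable (fun ω => _root_.deriv u (Z ω) * F ω) P :=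
    hFi.bdd_mul (hsm.mono hm).aestronglyMeasurable (Eventually.of_forall fun ω => hC _)
  have hL : ∫ ω, Z ω * u (Z ω) ∂P = ∫ ω, _root_.deriv u (Z ω) * F ω ∂P := by
    calc _ = _ := by
          refine integral_congr_ae ?_
          filter_upwards [h1.coeFn_toLp] with ω a
          rw [a, RCLike.inner_apply, conj_trivial]
      _ = _ := key.symm
      _ = _ := by
          refine integral_congr_ae ?_
          filter_upwards [h2.coeFn_toLp, Lp.coeFn_neg (deriv X P (Linv X P Z))] with ω a b
          rw [a, b, hF, hX.deriv_eq hU, real_inner_smul_left]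
          rfl
  rw [hL, ← integral_condExp hm]
  exact integral_congr_ae (condExp_mul_of_stronglyMeasurable_left hsm hprod hFi)

end IsIsonormal

end WienerSpace

/-! ### A Grönwall inequality -/

/-- A Grönwall inequality in integrated form, for the equation `F' = -c t F`. -/
lemma le_mul_exp_of_sub_le_integral {F : ℝ → ℝ} (hF : Continuous F) {c : ℝ}
    (h : ∀ a b, 0 ≤ a → a ≤ b → F b - F a ≤ -c * ∫ t in a..b, t * F t) {y : ℝ} (hy : 0 ≤ y) :
    F y ≤ F 0 * Real.exp (-c * y ^ 2 / 2) := by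
  let e : ℝ → ℝ := fun z => Real.exp (c * z ^ 2 / 2)
  have he : ∀ x, HasDerivAt e (e x * (c * x)) x := fun x => by
    have h1 := (((hasDerivAt_id x).pow 2).const_mul c).div_const 2 |>.exp
    refine h1.congr_deriv ?_
    simp only [e, id, Pi.pow_apply]
    norm_num
    ring_nf
  have hec : Continuous e := by fun_prop
  have hle : ∀ x ∈ Set.Icc 0 y, F x * e x ≤ F 0 := by
    refine image_le_of_liminf_slope_right_le_deriv_boundary (B' := fun _ => 0)
      (hF.mul hec).continuousOn (by simp [e]) continuousOn_const
      (fun x _ => (hasDerivAt_const x (F 0)).hasDerivWithinAt) fun x hx r hr => ?_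
    -- F need not be differentiable, so F e is compared with a constant through right slopes. R
    -- majorises the increment of F e from x, and its derivative at x is zero.
    let R : ℝ → ℝ := fun z => (-c * ∫ t in x..z, t * F t) * e z + F x * (e z - e x)
    have hR : HasDerivAt R 0 x := by
      have h1 : HasDerivAt (fun z => ∫ t in x..z, t * F t) (x * F x) x :=
        intervalIntegral.integral_hasDerivAt_right (by simp)
          ((by fun_prop : Continuous fun t => t * F t).stronglyMeasurableAtFilter _ _)
          (by fun_prop : Continuous fun t => t * F t).continuousAt
      refine (((h1.const_mul (-c)).mul (he x)).add
        (((he x).sub_const (e x)).const_mul (F x))).congr_deriv ?_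
      simp
      ring
    have hslope : ∀ᶠ z in 𝓝[>] x, slope R x z < r := by
      have := (hasDerivWithinAt_iff_tendsto_slope' Set.self_notMem_Ioi).1
        (hR.hasDerivWithinAt (s := Set.Ioi x))
      exact this.eventually (gt_mem_nhds hr)
    refine Eventually.frequently ?_
    filter_upwards [hslope, self_mem_nhdsWithin] with z hz hxz
    have hxz : x < z := hxz
    refine lt_of_le_of_lt ?_ hz
    rw [slope_def_field, slope_def_field]
    have hR0 : R x = 0 := by simp [R]
    have hpos : 0 < z - x := sub_pos.2 hxz
    rw [hR0, sub_zero]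
    gcongr
    have h2 := mul_le_mul_of_nonneg_right (h x z hx.1 hxz.le) (Real.exp_pos (c * z ^ 2 / 2)).le
    change F z * e z - F x * e x ≤ (-c * ∫ t in x..z, t * F t) * e z + F x * (e z - e x)
    change (F z - F x) * e z ≤ (-c * ∫ t in x..z, t * F t) * e z at h2
    linarith
  have h1 := hle y ⟨hy, le_rfl⟩
  have h2 : Real.exp (-c * y ^ 2 / 2) = (e y)⁻¹ := by
    rw [← Real.exp_neg]; congr 1; ring
  rw [h2, ← div_eq_mul_inv, le_div_iff₀ (Real.exp_pos _)]
  exact h1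

/-! ### From integration by parts to density bounds -/

section Density

variable {Ω : Type*} [MeasurableSpace Ω] {P : Measure Ω} {Z g : Ω → ℝ}

/-- The partial expectation `E (Z 1_{Z ≥ y})`. -/
noncomputable def tailMean (Z : Ω → ℝ) (P : Measure Ω) (y : ℝ) : ℝ :=
  ∫ ω, (Set.Ici y).indicator id (Z ω) ∂P

lemma abs_indicator_id_le (s : Set ℝ) (x : ℝ) : |s.indicator id x| ≤ |x| :=
  norm_indicator_le_norm_self id x

lemma integrable_indicator_comp (hZm : Measurable Z) (hZ : Integrable Z P) {s : Set ℝ}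
    (hs : MeasurableSet s) : Integrable (fun ω => s.indicator id (Z ω)) P :=
  hZ.mono ((measurable_id.indicator hs).comp hZm).aestronglyMeasurable
    (Eventually.of_forall fun _ => abs_indicator_id_le s _)

lemma abs_tailMean_le (hZ : Integrable Z P) (y : ℝ) :
    |tailMean Z P y| ≤ ∫ ω, |Z ω| ∂P := by
  rw [tailMean, ← Real.norm_eq_abs]
  exact norm_integral_le_of_norm_le hZ.abs
    (Eventually.of_forall fun ω => abs_indicator_id_le (Set.Ici y) (Z ω))

/-- For y ≤ 0, discarding the values of Z below y only raises the mean, which is 0. -/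
lemma tailMean_nonneg (hZm : Measurable Z) (hZ : Integrable Z P) (hZ0 : ∫ ω, Z ω ∂P = 0) (y : ℝ) :
    0 ≤ tailMean Z P y := by
  rcases le_total y 0 with h | h
  · rw [← hZ0]
    refine integral_mono hZ (integrable_indicator_comp hZm hZ measurableSet_Ici) fun ω => ?_
    by_cases hω : Z ω ∈ Set.Ici y
    · simp [Set.indicator_of_mem hω]
    · simp only [Set.indicator_of_notMem hω]
      exact (not_le.1 hω).le.trans h
  · refine integral_nonneg fun ω => Set.indicator_apply_nonneg fun hω => h.trans hω

lemma tailMean_zero (hZm : Measurable Z) (hZ : Integrable Z P) (hZ0 : ∫ ω, Z ω ∂P = 0) :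
    tailMean Z P 0 = (∫ ω, |Z ω| ∂P) / 2 := by
  have h : ∀ ω, |Z ω| = 2 * (Set.Ici (0 : ℝ)).indicator id (Z ω) - Z ω := fun ω => by
    by_cases hω : Z ω ∈ Set.Ici (0 : ℝ)
    · rw [Set.indicator_of_mem hω, abs_of_nonneg hω, id]; ring
    · rw [Set.indicator_of_notMem hω, abs_of_neg (not_le.1 hω)]; ring
  simp only [h]
  rw [integral_sub ((integrable_indicator_comp hZm hZ measurableSet_Ici).const_mul 2) hZ,
    integral_const_mul, hZ0, tailMean]
  ring

lemma measurable_tailMean [SFinite P] (hZm : Measurable Z) : Measurable (tailMean Z P) := by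
  have hset : MeasurableSet {p : ℝ × Ω | p.1 ≤ Z p.2} :=
    measurableSet_le measurable_fst (hZm.comp measurable_snd)
  have h : StronglyMeasurable ({p : ℝ × Ω | p.1 ≤ Z p.2}.indicator fun p => Z p.2) :=
    ((hZm.comp measurable_snd).indicator hset).stronglyMeasurable
  exact (h.integral_prod_right' (ν := P)).measurable

/-- Fubini on the region {y ≤ Z}. Moving the base point of the primitive from -∞ to 0 adds a
constant multiple of Z, which integrates to zero. -/
lemma integral_mul_integral_eq [IsFiniteMeasure P] (hZm : Measurable Z) (hZ : Integrable Z P)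
    (hZ0 : ∫ ω, Z ω ∂P = 0) {h : ℝ → ℝ} (hh : Integrable h) :
    ∫ ω, Z ω * (∫ x in (0 : ℝ)..Z ω, h x) ∂P = ∫ y, h y * tailMean Z P y := by
  have hset : MeasurableSet {p : Ω × ℝ | p.2 ≤ Z p.1} :=
    measurableSet_le measurable_snd (hZm.comp measurable_fst)
  have hint : Integrable ({p : Ω × ℝ | p.2 ≤ Z p.1}.indicator fun p => Z p.1 * h p.2)
      (P.prod volume) := (hZ.mul_prod hh).indicator hset
  have hswap := integral_integral_swap (μ := P) (ν := volume)
    (f := fun ω y => {p : Ω × ℝ | p.2 ≤ Z p.1}.indicator (fun p => Z p.1 * h p.2) (ω, y)) hint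
  have e1 : ∀ ω, ∫ y, {p : Ω × ℝ | p.2 ≤ Z p.1}.indicator (fun p => Z p.1 * h p.2) (ω, y)
      = Z ω * ∫ y in Set.Iic (Z ω), h y := fun ω => by
    rw [← integral_const_mul, ← integral_indicator measurableSet_Iic]
    rfl
  have e2 : ∀ y, ∫ ω, {p : Ω × ℝ | p.2 ≤ Z p.1}.indicator (fun p => Z p.1 * h p.2) (ω, y) ∂P
      = h y * tailMean Z P y := fun y => by
    rw [tailMean, ← integral_const_mul]
    congr 1
    ext ω
    by_cases hω : y ≤ Z ω
    · rw [Set.indicator_of_mem (by exact hω), Set.indicator_of_mem (by exact hω), id, mul_comm]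
    · rw [Set.indicator_of_notMem (by exact hω), Set.indicator_of_notMem (by exact hω), mul_zero]
  simp only [e1, e2] at hswap
  rw [← hswap]
  have e3 : ∀ ω, Z ω * (∫ x in (0 : ℝ)..Z ω, h x)
      = Z ω * (∫ y in Set.Iic (Z ω), h y) - Z ω * ∫ y in Set.Iic 0, h y := fun ω => by
    rw [← intervalIntegral.integral_Iic_sub_Iic hh.integrableOn hh.integrableOn, mul_sub]
  simp only [e3]
  have i1 : Integrable (fun ω => Z ω * ∫ y in Set.Iic (Z ω), h y) P := by
    have := hint.integral_prod_left
    simpa only [e1] using this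
  rw [integral_sub i1 (hZ.mul_const _), integral_mul_const, hZ0]
  simp

lemma integral_indicator_Icc_mul_eq [IsFiniteMeasure P] (hZm : Measurable Z) (hZ : Integrable Z P)
    (hZ0 : ∫ ω, Z ω ∂P = 0) (hg : Integrable g P)
    (hibp : ∀ h : ℝ → ℝ, ContDiff ℝ (⊤ : ℕ∞) h → HasCompactSupport h →
      ∫ ω, Z ω * (∫ x in (0 : ℝ)..Z ω, h x) ∂P = ∫ ω, h (Z ω) * g ω ∂P) {a b : ℝ} (hab : a ≤ b) :
    ∫ ω in Z ⁻¹' Set.Icc a b, g ω ∂P = ∫ y in Set.Icc a b, tailMean Z P y := by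
  set c := (a + b) / 2 with hc
  set r := (b - a) / 2 with hr
  have hr0 : 0 ≤ r := by rw [hr]; linarith
  have hball : Set.Icc a b = Metric.closedBall c r := by
    rw [Real.closedBall_eq_Icc]; congr 1 <;> rw [hc, hr] <;> ring
  let d : ℕ → ℝ := fun N => 1 / ((N : ℝ) + 1)
  have hd0 : ∀ N, 0 < d N := fun N => by positivity
  have hd1 : ∀ N, d N ≤ 1 := fun N =>
    div_le_one_of_le₀ (by linarith [N.cast_nonneg (α := ℝ)]) (by positivity)
  have hdlim : Tendsto d atTop (𝓝 0) := tendsto_one_div_add_atTop_nhds_zero_nat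
  -- Smooth bumps decreasing to the indicator of [a, b]. The inner radius exceeds r because it must
  -- be positive, while r = 0 when a = b.
  let f : ∀ _ : ℕ, ContDiffBump c := fun N =>
    ⟨r + d N / 2, r + d N, by linarith [hd0 N], by linarith [hd0 N]⟩
  have hf1 : ∀ N x, ‖f N x‖ ≤ 1 := fun N x => by
    rw [Real.norm_of_nonneg (f N).nonneg]; exact (f N).le_one
  have hlim : ∀ x, Tendsto (fun N => f N x) atTop (𝓝 ((Set.Icc a b).indicator 1 x)) := by
    intro x
    by_cases hx : x ∈ Set.Icc a b
    · rw [Set.indicator_of_mem hx]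
      refine tendsto_const_nhds.congr fun N => ?_
      refine ((f N).one_of_mem_closedBall ?_).symm
      rw [hball] at hx
      exact Metric.closedBall_subset_closedBall (by change r ≤ r + d N / 2; linarith [hd0 N]) hx
    · rw [Set.indicator_of_notMem hx]
      have hx' : r < dist x c := by
        rw [hball] at hx; simpa using hx
      have hev : ∀ᶠ N in atTop, r + d N < dist x c := by
        have : Tendsto (fun N => r + d N) atTop (𝓝 r) := by simpa using hdlim.const_add r
        exact this.eventually (gt_mem_nhds hx')
      refine tendsto_const_nhds.congr' ?_
      filter_upwards [hev] with N hN
      exact ((f N).zero_of_le_dist hN.le).symm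
  have heq : ∀ N, ∫ ω, f N (Z ω) * g ω ∂P = ∫ y, f N y * tailMean Z P y := fun N => by
    rw [← hibp _ (f N).contDiff (f N).hasCompactSupport]
    exact integral_mul_integral_eq hZm hZ hZ0
      ((f N).continuous.integrable_of_hasCompactSupport (f N).hasCompactSupport)
  have l1 : Tendsto (fun N => ∫ ω, f N (Z ω) * g ω ∂P) atTop
      (𝓝 (∫ ω, (Set.Icc a b).indicator 1 (Z ω) * g ω ∂P)) := by
    refine tendsto_integral_of_dominated_convergence (fun ω => |g ω|)
      (fun N => ((f N).continuous.measurable.comp hZm).aestronglyMeasurable.mul hg.1) hg.abs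
      (fun N => Eventually.of_forall fun ω => ?_)
      (Eventually.of_forall fun ω => (hlim (Z ω)).mul_const _)
    rw [norm_mul]
    exact mul_le_of_le_one_left (norm_nonneg _) (hf1 N _)
  have l2 : Tendsto (fun N => ∫ y, f N y * tailMean Z P y) atTop
      (𝓝 (∫ y, (Set.Icc a b).indicator 1 y * tailMean Z P y)) := by
    refine tendsto_integral_of_dominated_convergence
      ((Metric.closedBall c (r + 1)).indicator fun _ => ∫ ω, |Z ω| ∂P)
      (fun N => (f N).continuous.aestronglyMeasurable.mul
        (measurable_tailMean hZm).aestronglyMeasurable)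
      ((integrable_indicator_iff Metric.isClosed_closedBall.measurableSet).2
        (integrableOn_const (measure_closedBall_lt_top (μ := volume)).ne))
      (fun N => Eventually.of_forall fun y => ?_)
      (Eventually.of_forall fun y => (hlim y).mul_const _)
    by_cases hy : y ∈ Metric.closedBall c (r + 1)
    · rw [Set.indicator_of_mem hy, norm_mul]
      exact (mul_le_of_le_one_left (norm_nonneg _) (hf1 N _)).trans (abs_tailMean_le hZ y)
    · rw [Set.indicator_of_notMem hy, (f N).zero_of_le_dist, zero_mul, norm_zero]
      have : r + 1 < dist y c := by simpa using hy
      change r + d N ≤ _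
      linarith [hd1 N]
  have h := tendsto_nhds_unique l1 (by simpa only [heq] using l2)
  rw [← integral_indicator (hZm measurableSet_Icc), ← integral_indicator measurableSet_Icc]
  convert h using 2
  · ext ω
    by_cases hω : Z ω ∈ Set.Icc a b
    · rw [Set.indicator_of_mem (by exact hω), Set.indicator_of_mem hω]; simp
    · rw [Set.indicator_of_notMem (by exact hω), Set.indicator_of_notMem hω]; simp
  · ext y
    by_cases hω : y ∈ Set.Icc a b
    · rw [Set.indicator_of_mem hω, Set.indicator_of_mem hω]; simp
    · rw [Set.indicator_of_notMem hω, Set.indicator_of_notMem hω]; simp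

lemma map_withDensity_eq [IsFiniteMeasure P] (hZm : Measurable Z) (hZ : Integrable Z P)
    (hZ0 : ∫ ω, Z ω ∂P = 0) (hg : Integrable g P) (hg0 : 0 ≤ᵐ[P] g)
    (hibp : ∀ h : ℝ → ℝ, ContDiff ℝ (⊤ : ℕ∞) h → HasCompactSupport h →
      ∫ ω, Z ω * (∫ x in (0 : ℝ)..Z ω, h x) ∂P = ∫ ω, h (Z ω) * g ω ∂P) :
    (P.withDensity fun ω => ENNReal.ofReal (g ω)).map Z
      = volume.withDensity fun y => ENNReal.ofReal (tailMean Z P y) := by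
  have hfin := isFiniteMeasure_withDensity_ofReal hg.2
  refine Measure.ext_of_Icc _ _ fun a b hab => ?_
  rw [Measure.map_apply hZm measurableSet_Icc, withDensity_apply _ (hZm measurableSet_Icc),
    withDensity_apply _ measurableSet_Icc,
    ← ofReal_integral_eq_lintegral_ofReal hg.integrableOn (ae_restrict_of_ae hg0),
    ← ofReal_integral_eq_lintegral_ofReal _
      (Eventually.of_forall fun y => tailMean_nonneg hZm hZ hZ0 y),
    integral_indicator_Icc_mul_eq hZm hZ hZ0 hg hibp hab]
  exact Measure.integrableOn_of_bounded measure_Icc_lt_top.ne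
    (measurable_tailMean hZm).aestronglyMeasurable
    (Eventually.of_forall fun y => abs_tailMean_le hZ y)

lemma mul_map_le_map_withDensity (hZm : Measurable Z) {s : ℝ} (hs : ∀ᵐ ω ∂P, s ≤ g ω) {A : Set ℝ}
    (hA : MeasurableSet A) : ENNReal.ofReal s * P.map Z A
      ≤ (P.withDensity fun ω => ENNReal.ofReal (g ω)).map Z A := by
  rw [Measure.map_apply hZm hA, Measure.map_apply hZm hA, withDensity_apply _ (hZm hA),
    ← setLIntegral_const]
  refine lintegral_mono_ae (ae_restrict_of_ae ?_)
  filter_upwards [hs] with ω hω using ENNReal.ofReal_le_ofReal hω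

lemma map_withDensity_le_mul_map (hZm : Measurable Z) {s : ℝ} (hs : ∀ᵐ ω ∂P, g ω ≤ s) {A : Set ℝ}
    (hA : MeasurableSet A) : (P.withDensity fun ω => ENNReal.ofReal (g ω)).map Z A
      ≤ ENNReal.ofReal s * P.map Z A := by
  rw [Measure.map_apply hZm hA, Measure.map_apply hZm hA, withDensity_apply _ (hZm hA),
    ← setLIntegral_const]
  refine lintegral_mono_ae (ae_restrict_of_ae ?_)
  filter_upwards [hs] with ω hω using ENNReal.ofReal_le_ofReal hω

lemma tailMean_sub (hZm : Measurable Z) (hZ : Integrable Z P) {a b : ℝ} (hab : a ≤ b) :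
    tailMean Z P a - tailMean Z P b = ∫ ω, (Set.Ico a b).indicator id (Z ω) ∂P := by
  rw [tailMean, tailMean, ← integral_sub (integrable_indicator_comp hZm hZ measurableSet_Ici)
    (integrable_indicator_comp hZm hZ measurableSet_Ici)]
  congr 1
  ext ω
  by_cases h1 : a ≤ Z ω
  · by_cases h2 : b ≤ Z ω
    · simp [Set.indicator, h1, h2, not_lt.2 h2]
    · simp [Set.indicator, h1, h2, not_le.1 h2]
  · have h2 : ¬ b ≤ Z ω := fun h => h1 (hab.trans h)
    simp [Set.indicator, h1, h2]

/-- Two-sided Gaussian bounds on the density, from the integration by parts formula. -/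
theorem hasPDF_and_bounds [IsFiniteMeasure P] (hZm : Measurable Z) (hZ : Integrable Z P)
    (hZ0 : ∫ ω, Z ω ∂P = 0) (hg : Integrable g P) {s S : ℝ} (hs : 0 < s) (hS : 0 < S)
    (hgs : ∀ᵐ ω ∂P, s ≤ g ω ∧ g ω ≤ S)
    (hibp : ∀ h : ℝ → ℝ, ContDiff ℝ (⊤ : ℕ∞) h → HasCompactSupport h →
      ∫ ω, Z ω * (∫ x in (0 : ℝ)..Z ω, h x) ∂P = ∫ ω, h (Z ω) * g ω ∂P) :
    HasPDF Z P volume ∧ ∀ᵐ z : ℝ,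
      (∫ ω, |Z ω| ∂P) / (2 * S) * Real.exp (-z ^ 2 / (2 * s)) ≤ (pdf Z P volume z).toReal ∧
      (pdf Z P volume z).toReal ≤ (∫ ω, |Z ω| ∂P) / (2 * s) * Real.exp (-z ^ 2 / (2 * S)) := by
  have hg0 : 0 ≤ᵐ[P] g := by filter_upwards [hgs] with ω h using hs.le.trans h.1
  have hν := map_withDensity_eq hZm hZ hZ0 hg hg0 hibp
  set η := tailMean Z P with hη
  have hηm : Measurable η := measurable_tailMean hZm
  have hη0 : ∀ y, 0 ≤ η y := tailMean_nonneg hZm hZ hZ0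
  have hlow : ∀ A, MeasurableSet A → ENNReal.ofReal s * P.map Z A
      ≤ ∫⁻ y in A, ENNReal.ofReal (η y) := fun A hA => by
    rw [← withDensity_apply _ hA, ← hν]
    exact mul_map_le_map_withDensity hZm (hgs.mono fun _ h => h.1) hA
  have hupp : ∀ A, MeasurableSet A → ∫⁻ y in A, ENNReal.ofReal (η y)
      ≤ ENNReal.ofReal S * P.map Z A := fun A hA => by
    rw [← withDensity_apply _ hA, ← hν]
    exact map_withDensity_le_mul_map hZm (hgs.mono fun _ h => h.2) hA
  -- The strictly positive lower bound on g enters here: a null set for η dy is null for the law of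
  -- Z.
  have hac : P.map Z ≪ volume := by
    refine Measure.AbsolutelyContinuous.mk fun A hA hA0 => ?_
    have h1 := hlow A hA
    rw [Measure.restrict_eq_zero.2 hA0, lintegral_zero_measure, nonpos_iff_eq_zero,
      mul_eq_zero] at h1
    exact h1.resolve_left (ENNReal.ofReal_pos.2 hs).ne'
  have hpdf : HasPDF Z P volume := ⟨hZm.aemeasurable, inferInstance, hac⟩
  refine ⟨hpdf, ?_⟩
  set ρ := pdf Z P volume with hρ
  have hρm : Measurable ρ := measurable_pdf Z P volume
  have hμ : ∀ A, MeasurableSet A → P.map Z A = ∫⁻ y in A, ρ y := fun A hA =>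
    map_eq_setLIntegral_pdf Z P volume hA
  have b1 : ∀ᵐ y, ENNReal.ofReal s * ρ y ≤ ENNReal.ofReal (η y) := by
    refine ae_le_of_forall_setLIntegral_le_of_sigmaFinite (hρm.const_mul _) fun A hA _ => ?_
    rw [lintegral_const_mul _ hρm, ← hμ A hA]
    exact hlow A hA
  have b2 : ∀ᵐ y, ENNReal.ofReal (η y) ≤ ENNReal.ofReal S * ρ y := by
    refine ae_le_of_forall_setLIntegral_le_of_sigmaFinite hηm.ennreal_ofReal fun A hA _ => ?_
    rw [lintegral_const_mul _ hρm, ← hμ A hA]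
    exact hupp A hA
  have hbd : ∀ᵐ y, s * (ρ y).toReal ≤ η y ∧ η y ≤ S * (ρ y).toReal := by
    have hfin : ∀ᵐ y, ρ y < ⊤ := pdf.ae_lt_top
    filter_upwards [b1, b2, hfin] with y h1 h2 h3
    have h1' := ENNReal.toReal_mono ENNReal.ofReal_ne_top h1
    have h2' := ENNReal.toReal_mono (ENNReal.mul_ne_top ENNReal.ofReal_ne_top h3.ne) h2
    rw [ENNReal.toReal_mul, ENNReal.toReal_ofReal hs.le, ENNReal.toReal_ofReal (hη0 y)] at h1'
    rw [ENNReal.toReal_mul, ENNReal.toReal_ofReal hS.le, ENNReal.toReal_ofReal (hη0 y)] at h2'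
    exact ⟨h1', h2'⟩
  let k : ℝ → ℝ := fun z => (ρ z).toReal * z
  have hk : Integrable k := by
    have hid : AEStronglyMeasurable (id : ℝ → ℝ) volume := measurable_id.aestronglyMeasurable
    exact (pdf.integrable_pdf_smul_iff (X := Z) hid).2 hZ
  -- The integrated form of η' = -zρ; it also yields continuity of η.
  have hincr : ∀ a b, a ≤ b → η a - η b = ∫ z in a..b, k z := fun a b hab => by
    rw [hη, tailMean_sub hZm hZ hab, intervalIntegral.integral_of_le hab,
      ← integral_Ico_eq_integral_Ioc, ← integral_indicator measurableSet_Ico,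
      ← pdf.integral_pdf_smul (μ := (volume : Measure ℝ)) (X := Z)
        (f := (Set.Ico a b).indicator id)
        (measurable_id.indicator measurableSet_Ico).aestronglyMeasurable]
    congr 1
    ext z
    by_cases hz : z ∈ Set.Ico a b
    · simp [Set.indicator_of_mem hz, k, hρ]
    · simp [Set.indicator_of_notMem hz]
  have hηc : Continuous η := by
    have h1 : η = fun y => η 0 - ∫ z in (0 : ℝ)..y, k z := by
      ext y
      rcases le_total 0 y with h | h
      · rw [← hincr 0 y h]; ring
      · rw [intervalIntegral.integral_symm, ← hincr y 0 h]; ring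
    rw [h1]
    exact continuous_const.sub (intervalIntegral.continuous_primitive
      (fun a b => hk.intervalIntegrable) 0)
  have hneg : ∀ᵐ y, s * (ρ (-y)).toReal ≤ η (-y) ∧ η (-y) ≤ S * (ρ (-y)).toReal :=
    (Measure.measurePreserving_neg (volume : Measure ℝ)).quasiMeasurePreserving.ae hbd
  have hkn : Integrable fun z => k (-z) := hk.comp_neg
  -- Both half-lines at once: κ is η or its reflection, and q below is ρ(z) or ρ(-z) accordingly,
  -- with κ' = -zq in either case.
  have hbounds : ∀ (κ : ℝ → ℝ), (κ = η ∨ κ = fun y => η (-y)) → ∀ y, 0 ≤ y →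
      κ y ≤ κ 0 * Real.exp (-(1 / S) * y ^ 2 / 2) ∧
      κ 0 * Real.exp (-(1 / s) * y ^ 2 / 2) ≤ κ y := by
    intro κ hκ
    obtain ⟨hκc, q, hq, hqi, hqb⟩ : Continuous κ ∧ ∃ q : ℝ → ℝ, (∀ a b, 0 ≤ a → a ≤ b →
        κ b - κ a = - ∫ z in a..b, q z * z) ∧ Integrable (fun z => q z * z) ∧
        ∀ᵐ y, s * q y ≤ κ y ∧ κ y ≤ S * q y := by
      rcases hκ with rfl | rfl
      · exact ⟨hηc, fun z => (ρ z).toReal, fun a b _ hab => by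
          have := hincr a b hab
          simp only [k] at this
          linarith, hk, hbd⟩
      · refine ⟨hηc.comp continuous_neg, fun z => (ρ (-z)).toReal, fun a b _ hab => ?_, ?_, hneg⟩
        · have h1 := hincr (-b) (-a) (by linarith)
          rw [h1, ← intervalIntegral.integral_comp_neg, ← intervalIntegral.integral_neg]
          simp [k]
        · simpa [k] using hkn.neg
    have hcomp : ∀ a b, 0 ≤ a → a ≤ b →
        (1 / S) * (∫ z in a..b, z * κ z) ≤ (∫ z in a..b, q z * z) ∧
        (∫ z in a..b, q z * z) ≤ (1 / s) * ∫ z in a..b, z * κ z := by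
      intro a b ha hab
      have hi : IntervalIntegrable (fun z => z * κ z) volume a b :=
        (continuous_id.mul hκc).intervalIntegrable _ _
      rw [← intervalIntegral.integral_const_mul, ← intervalIntegral.integral_const_mul]
      constructor
      · refine intervalIntegral.integral_mono_ae_restrict hab (hi.const_mul _)
          hqi.intervalIntegrable ?_
        filter_upwards [ae_restrict_of_ae hqb, ae_restrict_mem measurableSet_Icc] with z hz hzab
        rw [mul_left_comm, mul_comm (q z)]
        refine mul_le_mul_of_nonneg_left ?_ (ha.trans hzab.1)
        rw [one_div, inv_mul_le_iff₀ hS]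
        exact hz.2
      · refine intervalIntegral.integral_mono_ae_restrict hab hqi.intervalIntegrable
          (hi.const_mul _) ?_
        filter_upwards [ae_restrict_of_ae hqb, ae_restrict_mem measurableSet_Icc] with z hz hzab
        rw [mul_left_comm, mul_comm (q z)]
        refine mul_le_mul_of_nonneg_left ?_ (ha.trans hzab.1)
        rw [one_div, le_inv_mul_iff₀ hs]
        exact hz.1
    intro y hy
    constructor
    · refine le_mul_exp_of_sub_le_integral hκc (fun a b ha hab => ?_) hy
      rw [hq a b ha hab]
      linarith [(hcomp a b ha hab).1]
    -- The Grönwall lemma requires no sign of F, so the lower bound is the upper bound for -κ.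
    · have := le_mul_exp_of_sub_le_integral (F := fun z => -κ z) (c := 1 / s) hκc.neg
        (fun a b ha hab => ?_) hy
      · linarith
      · have h1 := hq a b ha hab
        have h2 := (hcomp a b ha hab).2
        simp only [mul_neg, intervalIntegral.integral_neg]
        linarith
  have hfinal : ∀ y, η y ≤ η 0 * Real.exp (-y ^ 2 / (2 * S)) ∧
      η 0 * Real.exp (-y ^ 2 / (2 * s)) ≤ η y := by
    have e : ∀ c y : ℝ, -(1 / c) * y ^ 2 / 2 = -y ^ 2 / (2 * c) := fun c y => by
      rw [mul_comm 2 c, ← div_div]; ring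
    intro y
    rcases le_total 0 y with h | h
    · have := hbounds η (Or.inl rfl) y h
      rwa [e, e] at this
    · have := hbounds _ (Or.inr rfl) (-y) (by linarith)
      rw [e, e] at this
      simpa using this
  filter_upwards [hbd] with z hz
  obtain ⟨h1, h2⟩ := hfinal z
  have h0 : η 0 = (∫ ω, |Z ω| ∂P) / 2 := tailMean_zero hZm hZ hZ0
  constructor
  · rw [← div_div, ← h0, div_mul_eq_mul_div, div_le_iff₀ hS]
    linarith [hz.2]
  · rw [← div_div, ← h0, div_mul_eq_mul_div, le_div_iff₀ hs]
    linarith [hz.1]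

end Density

end Malliavin

theorem corollary3p4 {Ω H : Type*}
    [NormedAddCommGroup H] [InnerProductSpace ℝ H] [CompleteSpace H]
    [TopologicalSpace.SeparableSpace H]
    [MeasurableSpace Ω] (P : Measure Ω) [IsProbabilityMeasure P]
    (X : H → Ω → ℝ) (hX : Malliavin.IsIsonormal X P)
    (Z : Lp ℝ 2 P) (hZ : Z ∈ Malliavin.D12 X P) (hZ0 : ∫ ω, Z ω ∂P = 0)
    (σmin σmax : ℝ) (hmin : 0 < σmin) (hmax : 0 < σmax)
    (hg : ∀ᵐ ω ∂P, σmin ^ 2 ≤ Malliavin.gZ X P Z ω ∧ Malliavin.gZ X P Z ω ≤ σmax ^ 2) :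
    HasPDF (fun ω => Z ω) P volume ∧
    ∀ᵐ z : ℝ,
      (∫ ω, |Z ω| ∂P) / (2 * σmax ^ 2) * Real.exp (-z ^ 2 / (2 * σmin ^ 2))
          ≤ (pdf (fun ω => Z ω) P volume z).toReal ∧
      (pdf (fun ω => Z ω) P volume z).toReal
          ≤ (∫ ω, |Z ω| ∂P) / (2 * σmin ^ 2) * Real.exp (-z ^ 2 / (2 * σmax ^ 2)) := by
  refine Malliavin.hasPDF_and_bounds (Lp.stronglyMeasurable Z).measurable
    ((Lp.memLp Z).integrable (by norm_num)) hZ0 integrable_condExp (by positivity) (by positivity)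
    hg fun h hh hc => ?_
  -- The function u is the primitive of the test function h vanishing at 0; its derivative h is
  -- bounded because it has compact support.
  have hd : ∀ x, HasDerivAt (fun z => ∫ t in (0 : ℝ)..z, h t) (h x) x := fun x =>
    intervalIntegral.integral_hasDerivAt_right (hh.continuous.intervalIntegrable _ _)
      (hh.continuous.stronglyMeasurableAtFilter _ _) hh.continuous.continuousAt
  have hderiv : deriv (fun z => ∫ t in (0 : ℝ)..z, h t) = h := funext fun x => (hd x).deriv
  have hu : ContDiff ℝ (⊤ : ℕ∞) (fun z => ∫ t in (0 : ℝ)..z, h t) := by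
    rw [contDiff_infty_iff_deriv, hderiv]
    exact ⟨fun x => (hd x).differentiableAt, hh⟩
  obtain ⟨C, hC⟩ := hc.exists_bound_of_continuous hh.continuous
  have key := hX.integral_mul_comp_eq hZ hZ0 hu (by simp) (C := C)
    (fun x => by rw [hderiv]; exact hC x)
  rwa [hderiv] at key
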